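/- **Theorem 1.2.** Consider the following zero-sum game of two players A and B. The game state is $p(t)=x+W_t$, run until it first reaches $0$ or $1$, where $W$ is a standard (driftless) Brownian motion with continuous paths relative to a filtration and $x\in[0,1]$ (the game itself starts at $x=1/2$); reaching $1$ means that A wins the current stake from B, reaching $0$ that B wins it from A. The subjective state of A is $p$, that of B is $1-p$. The initial stake is $1$. At most a given finite number of doubles may be played. Before the first double either player may propose it (if both propose at the same moment, the proposal of a fixed player counts); afterwards only the player who accepted the last double may propose the next one. A double may be proposed at any time up to and including the time when the state reaches $0$ or $1$. If it is declined, the game ends and the proposer wins the current stake; if it is accepted, the stake is doubled and play continues. Proposals are made at stopping times, responses depend only on what has been observed up to the proposal, and each player maximizes the expected payoff; play is called optimal if neither player can gain by changing strategy alone. Call $c\in[0,1]$ an optimal doubling state of a player in a position (a number $k\ge1$ of doubles remaining, the right to double, and the game state) if there is optimal play from that position in which, with $k$ doubles remaining, the player proposes as soon as his or her subjective state is at least $c$. For $k\ge 0$ put $$d_k=\frac45+\frac15\left(-\frac14\right)^k .$$ (a) For every initial state $x\in[0,1]$ there are strategies in which each player, whenever entitled to double with $j\ge1$ doubles remaining,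 proposes as soon as his or her subjective state is at least $d_j$, and which are optimal play whatever the number of doubles remaining and whoever has the right to double. (b) If $k\ge1$ doubles remain and only one player has the right to double, and the subjective state of that player lies in $(0,d_k)$, then $d_k$ is the one and only optimal doubling state of that player. (c) If $k\ge1$ doubles remain, both players have the right to double, and the game state lies in $(1-d_k,d_k)$ (for instance at $1/2$), then $d_k$ is the largest optimal doubling state of either player, and for $k\ge2$ it is the only one. -/

import Mathlib

open MeasureTheory ProbabilityTheory Set
open scoped NNReal

namespace DoublingGame

/-- `W` is a standard (driftless) Brownian motion relative to the filtration `ℱ`. -/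
structure IsBrownianMotion {Ω : Type*} {m : MeasurableSpace Ω} (W : ℝ≥0 → Ω → ℝ)
    (ℱ : Filtration ℝ≥0 m) (μ : Measure Ω) : Prop where
  isPreBrownian : IsPreBrownianReal W μ
  continuous_paths : ∀ ω, Continuous fun t => W t ω
  adapted : Adapted ℱ W
  indep_increments : ∀ s t : ℝ≥0, s ≤ t →
    Indep (MeasurableSpace.comap (fun ω => W t ω - W s ω) inferInstance) (ℱ s) μ

/-- The two players. -/
inductive Player
  | A
  | B
  deriving DecidableEq

namespace Player

/-- The opponent. -/
def opp : Player → Player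
  | A => B
  | B => A

/-- The game is zero-sum: a payment `v` to Player A is worth `P.sign * v` to `P`. -/
def sign : Player → ℝ
  | A => 1
  | B => -1

/-- The subjective game state of a player when the game state is `p`. -/
def view : Player → ℝ → ℝ
  | A, p => p
  | B, p => 1 - p

end Player

/-- Who currently has the right to propose the next double: both players (as long as nobody has
doubled yet) or one player only. -/
inductive Right
  | both
  | only (P : Player)

/-- A (nonanticipating) strategy of a player.

`propose k t ω` is the time at which the player proposes the next double (`⊤` if never) when he has
the right to do so, `k` doubles remain, and the previous double was accepted at time `t` (`t = 0`
if play starts with `k` doubles remaining).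

`fold k t` is the set of paths on which the player declines a double that the opponent
proposes at time `t` when `k` doubles remain (the proposed one included); on the other paths he
accepts it. -/
structure Strategy {Ω : Type*} {m : MeasurableSpace Ω} (ℱ : Filtration ℝ≥0 m) where
  propose : ℕ → ℝ≥0 → Ω → WithTop ℝ≥0
  fold : ℕ → ℝ≥0 → Set Ω
  le_propose : ∀ (k : ℕ) (t : ℝ≥0) (ω : Ω), (t : WithTop ℝ≥0) ≤ propose k t ω
  /-- Proposals use only the information available when they are made. -/
  isStoppingTime_propose : ∀ (k : ℕ) (ρ : Ω → WithTop ℝ≥0), IsStoppingTime ℱ ρ →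
    IsStoppingTime ℱ fun ω =>
      WithTop.recTopCoe (C := fun _ => WithTop ℝ≥0) ⊤ (fun t : ℝ≥0 => propose k t ω) (ρ ω)
  /-- Responses use only the information available when the double is proposed. -/
  measurableSet_fold : ∀ (k : ℕ) (ρ : Ω → WithTop ℝ≥0) (hρ : IsStoppingTime ℱ ρ),
    MeasurableSet[hρ.measurableSpace] {ω | ∃ t : ℝ≥0, ρ ω = t ∧ ω ∈ fold k t}

section Game

variable {Ω : Type*} {m : MeasurableSpace Ω} {ℱ : Filtration ℝ≥0 m}

/-- The game state at time `t`, when it is `x` at time `0`. It is relevant only up to the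
first time it reaches `0` or `1`. -/
def state (W : ℝ≥0 → Ω → ℝ) (x : ℝ) (t : ℝ≥0) (ω : Ω) : ℝ := x + W t ω

/-- The game state has not reached `0` or `1` before time `t` (it may do so at time `t`). -/
def Live (W : ℝ≥0 → Ω → ℝ) (x : ℝ) (t : ℝ≥0) (ω : Ω) : Prop :=
  ∀ s < t, state W x s ω ∈ Ioo (0 : ℝ) 1

open Classical in
/-- Payoff to Player A, per unit of stake, if no further double is proposed: `1` if the state
reaches `1` first and `-1` if it reaches `0` first. -/
noncomputable def outcome (W : ℝ≥0 → Ω → ℝ) (x : ℝ) (ω : Ω) : ℝ :=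
  if ∃ t, Live W x t ω ∧ state W x t ω = 1 then 1
  else if ∃ t, Live W x t ω ∧ state W x t ω = 0 then -1
  else 0

open Classical in
/-- Payoff to Player A, per unit of the current stake, on the path `ω`, when `k` doubles remain,
only `P` may propose the next one, and the previous one was accepted at time `t`.
A proposal counts only if it is made no later than the time when the state reaches `0` or `1`.
A declined double ends the game and the proposer wins the current stake; after an accepted double
the stake is doubled and the right to propose passes to the opponent. -/
noncomputable def soloPayoff (W : ℝ≥0 → Ω → ℝ) (x : ℝ) (σ : Player → Strategy ℱ) :
    ℕ → Player → ℝ≥0 → Ω → ℝ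
  | 0, _, _, ω => outcome W x ω
  | k + 1, P, t, ω =>
    let τ := (σ P).propose (k + 1) t ω
    let s := τ.untopD 0
    if τ ≠ ⊤ ∧ Live W x s ω then
      if ω ∈ (σ P.opp).fold (k + 1) s then P.sign
      else 2 * soloPayoff W x σ k P.opp s ω
    else outcome W x ω

/-- The player whose proposal comes first when both may propose; `tie` is the player whose
proposal counts if both are made at the same time. -/
noncomputable def firstProposer (σ : Player → Strategy ℱ) (tie : Player) (k : ℕ) (ω : Ω) :
    Player :=
  if (σ Player.A).propose k 0 ω < (σ Player.B).propose k 0 ω then Player.A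
  else if (σ Player.B).propose k 0 ω < (σ Player.A).propose k 0 ω then Player.B
  else tie

/-- Payoff to Player A, per unit of the current stake, on the path `ω`, when play starts at time
`0` with `k` doubles remaining. -/
noncomputable def payoff (W : ℝ≥0 → Ω → ℝ) (tie : Player) (k : ℕ) (r : Right) (x : ℝ)
    (σ : Player → Strategy ℱ) (ω : Ω) : ℝ :=
  match r with
  | Right.both => soloPayoff W x σ k (firstProposer σ tie k ω) 0 ω
  | Right.only P => soloPayoff W x σ k P 0 ω

/-- Expected payoff to Player A. -/
noncomputable def expectedPayoff (μ : Measure Ω) (W : ℝ≥0 → Ω → ℝ) (tie : Player) (k : ℕ)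
    (r : Right) (x : ℝ) (σ : Player → Strategy ℱ) : ℝ :=
  ∫ ω, payoff W tie k r x σ ω ∂μ

/-- Both players maximize their expected payoff: neither can gain by changing strategy. -/
def IsOptimalPlay (μ : Measure Ω) (W : ℝ≥0 → Ω → ℝ) (tie : Player) (k : ℕ)
    (r : Right) (x : ℝ) (σ : Player → Strategy ℱ) : Prop :=
  ∀ (P : Player) (s : Strategy ℱ),
    P.sign * expectedPayoff μ W tie k r x (Function.update σ P s)
      ≤ P.sign * expectedPayoff μ W tie k r x σ

/-- With `k` doubles remaining, the strategy `s` of `P` proposes a double as soon as the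
subjective game state of `P` is at least `c`. -/
def DoublesAt (W : ℝ≥0 → Ω → ℝ) (x : ℝ) (P : Player) (s : Strategy ℱ) (k : ℕ) (c : ℝ) : Prop :=
  ∀ t ω, s.propose k t ω = hittingAfter (fun u ω => P.view (state W x u ω)) (Ici c) t ω

/-- In the position with `k` doubles remaining, right to double `r` and game state `x`, it is
optimal for `P` to propose the next double as soon as his subjective game state is at
least `c`. -/
def IsOptimalDoublingState (ℱ : Filtration ℝ≥0 m) (μ : Measure Ω) (W : ℝ≥0 → Ω → ℝ)
    (tie : Player) (k : ℕ) (r : Right) (x : ℝ) (P : Player) (c : ℝ) : Prop :=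
  c ∈ Icc (0 : ℝ) 1 ∧
    ∃ σ : Player → Strategy ℱ, IsOptimalPlay μ W tie k r x σ ∧ DoublesAt W x P (σ P) k c

end Game

end DoublingGame

open DoublingGame

namespace DoublingGame

open Filter Topology

/-! ### Hitting times of closed sets by continuous adapted processes. -/

section Hitting

variable {Ω : Type*} {u : ℝ≥0 → Ω → ℝ} {S : Set ℝ} {ω : Ω} {s t i : ℝ≥0} {c : ℝ}

/-! Write d_k for the doubling states and V_k(p) = min(1, -1 + 2p/d_k) (`soloValue`). V_k is the
value for a player in subjective state p who alone may double. Stopping a driftless Brownian motion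
preserves expectations of affine functions, so the value is linear between losing at 0 (worth -1)
and cashing in at d_k (worth 1). A double proposed at p, with k further doubles left, lets the
responder choose between -1 and 2 V_k(1 - p). It is therefore worth min(1, -2 V_k(1 - p)) to the
proposer (`proposalValue`). The responder is indifferent where V_k(1 - p) = -1/2, that is at p = 1 -
d_k/4 = d_{k+1}; starting from d_0 = 1, this recursion has the stated closed form.

That threshold play guarantees V_k to either side is shown by induction on k, from every event known
at a stopping time (`setIntegral_soloPayoff_bounds`). For the upper bound, the value of a proposal
and the payoff 2p - 1 without one both lie below the concave V_{k+1}, whose expectation cannot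
increase under stopping. For the lower bound, threshold play from below d_{k+1} ends the stage at
d_{k+1} or at 0, and there the reward lies on the line.

When both players may double, the opponent's threshold keeps the state from falling below 1 - d_k
before the opponent proposes. The value is the line from -1 at 1 - d_k to 1 at d_k, cut off at -1
and 1 (`openingReward_le_line`). Since the game is zero-sum, the upper bound against a threshold
opponent, applied to each player, makes the threshold strategies a saddle point
(`isOptimalPlay_threshold`).

For uniqueness, an optimal doubling state c attains the value against a threshold opponent. If c
differs from d_k, the reward is strictly below the line unless the stage ends at its lower endpoint.
Equal expectations would then put the stopped state at that endpoint almost surely, against the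
martingale property (`integral_lt_affine`). Before the first double this compares the slope 2/(2d_k
- 1) of the line with the slope 4/d_{k-1} of the value of a proposal. They agree exactly when
d_{k-1} = 1, that is for k = 1, so with one double left only states above d_1 are excluded. -/

theorem eq_top_or_eq_coe (a : WithTop ℝ≥0) : a = ⊤ ∨ ∃ t : ℝ≥0, a = t :=
  a.recTopCoe (Or.inl rfl) fun t => Or.inr ⟨t, rfl⟩

/-- For a closed set and a continuous path the set of visiting times is closed, so the infimum
defining the hitting time is attained. -/
theorem mem_of_hittingAfter_eq (hc : Continuous fun s => u s ω) (hS : IsClosed S)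
    (h : hittingAfter u S t ω = s) : t ≤ s ∧ u s ω ∈ S := by
  classical
  rw [hittingAfter_def] at h
  dsimp only at h
  split_ifs at h with hex
  swap
  · exact absurd h WithTop.top_ne_coe
  have hcl : IsClosed {i : ℝ≥0 | t ≤ i ∧ u i ω ∈ S} := isClosed_Ici.inter (hS.preimage hc)
  have := hcl.csInf_mem hex (OrderBot.bddBelow _)
  rw [WithTop.coe_inj.mp h] at this
  exact this

theorem hittingAfter_le_iff_of_isClosed (hc : Continuous fun s => u s ω) (hS : IsClosed S) :
    hittingAfter u S t ω ≤ i ↔ ∃ s ∈ Icc t i, u s ω ∈ S := by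
  constructor
  · intro h
    obtain ⟨s, hs⟩ := WithTop.ne_top_iff_exists.mp (ne_top_of_le_ne_top WithTop.coe_ne_top h)
    obtain ⟨h1, h2⟩ := mem_of_hittingAfter_eq hc hS hs.symm
    rw [← hs] at h
    exact ⟨s, ⟨h1, WithTop.coe_le_coe.mp h⟩, h2⟩
  · rintro ⟨s, hs, hS'⟩
    exact (hittingAfter_le_of_mem hs.1 hS').trans (WithTop.coe_le_coe.mpr hs.2)

theorem hittingAfter_eq_self (h : u t ω ∈ S) : hittingAfter u S t ω = t :=
  le_antisymm (hittingAfter_le_of_mem le_rfl h) (le_hittingAfter ω)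

/-- A continuous path that starts below `c` stays weakly below `c` until it hits `[c, ∞)`. -/
theorem le_of_le_hittingAfter (hc : Continuous fun s => u s ω) (h0 : u t ω ≤ c) (hts : t ≤ s)
    (h : (s : WithTop ℝ≥0) ≤ hittingAfter u (Ici c) t ω) : u s ω ≤ c := by
  rcases hts.eq_or_lt with rfl | hlt
  · exact h0
  by_contra! hcs
  obtain ⟨r, hr, hrc⟩ := intermediate_value_Icc hts hc.continuousOn ⟨h0, hcs.le⟩
  have hrs : r ≠ s := by rintro rfl; exact hcs.ne' hrc
  refine notMem_of_lt_hittingAfter (u := u) (s := Ici c) (n := t) (ω := ω) (k := r)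
    (lt_of_lt_of_le ?_ h) hr.1 hrc.ge
  exact WithTop.coe_lt_coe.mpr (lt_of_le_of_ne hr.2 hrs)

theorem eq_of_hittingAfter_eq (hc : Continuous fun s => u s ω) (h0 : u t ω ≤ c)
    (h : hittingAfter u (Ici c) t ω = s) : u s ω = c := by
  obtain ⟨h1, h2⟩ := mem_of_hittingAfter_eq hc isClosed_Ici h
  exact le_antisymm (le_of_le_hittingAfter hc h0 h1 h.ge) h2

variable {m : MeasurableSpace Ω} {ℱ : Filtration ℝ≥0 m}

theorem isStronglyProgressive_of_adapted (hu : Adapted ℱ u)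
    (hc : ∀ ω, Continuous fun s => u s ω) : IsStronglyProgressive ℱ u :=
  StronglyAdapted.isStronglyProgressive_of_continuous (fun i => (hu i).stronglyMeasurable) hc

/-- The value of `F` at the (possibly infinite) time `ρ`, and `⊤` if that time is infinite. -/
noncomputable def timeAfter (F : ℝ≥0 → Ω → WithTop ℝ≥0) (ρ : Ω → WithTop ℝ≥0) (ω : Ω) :
    WithTop ℝ≥0 :=
  WithTop.recTopCoe (C := fun _ => WithTop ℝ≥0) ⊤ (fun t : ℝ≥0 => F t ω) (ρ ω)

theorem timeAfter_of_eq {F : ℝ≥0 → Ω → WithTop ℝ≥0} {ρ : Ω → WithTop ℝ≥0} (h : ρ ω = t) :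
    timeAfter F ρ ω = F t ω := by
  rw [timeAfter, h]; rfl

theorem timeAfter_of_top {F : ℝ≥0 → Ω → WithTop ℝ≥0} {ρ : Ω → WithTop ℝ≥0} (h : ρ ω = ⊤) :
    timeAfter F ρ ω = ⊤ := by
  simp [timeAfter, h]

theorem le_timeAfter {F : ℝ≥0 → Ω → WithTop ℝ≥0} (hF : ∀ (t : ℝ≥0) ω, (t : WithTop ℝ≥0) ≤ F t ω)
    (ρ : Ω → WithTop ℝ≥0) : ρ ≤ timeAfter F ρ := by
  intro ω
  obtain h | ⟨t, h⟩ := eq_top_or_eq_coe (ρ ω)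
  · rw [timeAfter_of_top h]; exact le_top
  · rw [timeAfter_of_eq h, h]; exact hF t ω

/-- The first time after a stopping time at which a continuous adapted process is in a closed set
is a stopping time. -/
theorem isStoppingTime_timeAfter_hittingAfter (hu : Adapted ℱ u)
    (hc : ∀ ω, Continuous fun s => u s ω) (hS : IsClosed S) (hne : S.Nonempty)
    {ρ : Ω → WithTop ℝ≥0} (hρ : IsStoppingTime ℱ ρ) :
    IsStoppingTime ℱ (timeAfter (hittingAfter u S) ρ) := by
  intro i
  obtain ⟨D, hDc, hD⟩ := TopologicalSpace.exists_countable_dense ℝ≥0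
  -- Clamping q to the interval from `ρ` to `i` makes the process at that time measurable at time
  -- `i`. By compactness, the set is visited in this interval iff the distance to it gets below
  -- every 1/(n+1) there, and by continuity countably many q suffice to test this.
  let r : ℝ≥0 → Ω → WithTop ℝ≥0 := fun q ω => min (max (ρ ω) q) i
  let Y : ℝ≥0 → Ω → ℝ := fun q => stoppedValue u (r q)
  have hY : ∀ q, Measurable[ℱ i] (Y q) := fun q =>
    (stronglyMeasurable_stoppedValue_of_le (isStronglyProgressive_of_adapted hu hc)
      ((hρ.max_const q).min_const i) fun _ => min_le_right _ _).measurable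
  have hYd : ∀ q, Measurable[ℱ i] fun ω => Metric.infDist (Y q ω) S := fun q =>
    (Metric.continuous_infDist_pt S).measurable.comp (hY q)
  have hYt : ∀ ω (t : ℝ≥0), ρ ω = t → ∀ q, Y q ω = u (min (max t q) i) ω := by
    intro ω t ht q
    simp only [Y, r, stoppedValue, ht]
    norm_cast
  have key : {ω | timeAfter (hittingAfter u S) ρ ω ≤ i} =
      {ω | ρ ω ≤ i} ∩ ⋂ n : ℕ, ⋃ q ∈ D, {ω | Metric.infDist (Y q ω) S < 1 / ((n : ℝ) + 1)} := by
    ext ω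
    simp only [mem_ofPred_eq, mem_inter_iff, mem_iInter, mem_iUnion, exists_prop]
    obtain hρω | ⟨t, hρω⟩ := eq_top_or_eq_coe (ρ ω)
    · rw [timeAfter_of_top hρω, hρω]
      exact ⟨fun h => absurd h (WithTop.not_top_le_coe i),
        fun h => absurd h.1 (WithTop.not_top_le_coe i)⟩
    rw [timeAfter_of_eq hρω, hρω, hittingAfter_le_iff_of_isClosed (hc ω) hS]
    have hcont : Continuous fun q => Metric.infDist (Y q ω) S := by
      simp only [hYt ω t hρω]
      exact (Metric.continuous_infDist_pt S).comp ((hc ω).comp (by fun_prop))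
    constructor
    · rintro ⟨s, hs, hsS⟩
      refine ⟨WithTop.coe_le_coe.mpr (hs.1.trans hs.2), fun n => ?_⟩
      have hopen : IsOpen {q | Metric.infDist (Y q ω) S < 1 / ((n : ℝ) + 1)} :=
        isOpen_lt hcont continuous_const
      refine (hD.inter_open_nonempty _ hopen ⟨s, ?_⟩).imp fun q hq => ⟨hq.2, hq.1⟩
      simp only [mem_ofPred_eq, hYt ω t hρω, max_eq_right hs.1, min_eq_left hs.2,
        Metric.infDist_zero_of_mem hsS]
      positivity
    · rintro ⟨hti, h⟩
      have hti' : t ≤ i := WithTop.coe_le_coe.mp hti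
      obtain ⟨s, hs, hmin⟩ := isCompact_Icc.exists_isMinOn (nonempty_Icc.mpr hti')
        (f := fun s => Metric.infDist (u s ω) S)
        ((Metric.continuous_infDist_pt S).comp (hc ω)).continuousOn
      refine ⟨s, hs, (hS.mem_iff_infDist_zero hne).mpr ?_⟩
      refine le_antisymm (le_of_forall_pos_le_add fun ε hε => ?_) Metric.infDist_nonneg
      obtain ⟨n, hn⟩ := exists_nat_one_div_lt hε
      obtain ⟨q, -, hq⟩ := h n
      rw [hYt ω t hρω] at hq
      have := hmin (a := min (max t q) i) ⟨le_min (le_max_left _ _) hti', min_le_right _ _⟩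
      simp only [mem_ofPred_eq] at this
      linarith
  rw [key]
  exact (hρ i).inter (MeasurableSet.iInter fun n => MeasurableSet.biUnion hDc fun q _ =>
    measurableSet_lt (hYd q) measurable_const)

end Hitting

/-! ### Optional stopping for continuous martingales at bounded times. -/

section OptionalStopping

variable {Ω : Type*} {m : MeasurableSpace Ω} {μ : Measure Ω} [IsProbabilityMeasure μ]
  {ℱ : Filtration ℝ≥0 m} {f : ℝ≥0 → Ω → ℝ}

/-- The least multiple of `1 / (n + 1)` larger than `t`, capped at `N`. -/
noncomputable def roundUp (n : ℕ) (N t : ℝ≥0) : ℝ≥0 := min ((⌊(n + 1) * t⌋₊ + 1) / (n + 1)) N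

theorem le_roundUp (n : ℕ) {N t : ℝ≥0} (h : t ≤ N) : t ≤ roundUp n N t := by
  refine le_min ?_ h
  rw [le_div_iff₀ (by positivity), mul_comm]
  exact (Nat.lt_floor_add_one _).le

theorem roundUp_le_add (n : ℕ) (N t : ℝ≥0) : roundUp n N t ≤ t + 1 / (n + 1) := by
  refine (min_le_left _ _).trans ?_
  rw [add_div]
  gcongr
  rw [div_le_iff₀ (by positivity), mul_comm]
  exact Nat.floor_le (by positivity)

theorem tendsto_roundUp {N t : ℝ≥0} (h : t ≤ N) :
    Tendsto (fun n => roundUp n N t) atTop (𝓝 t) := by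
  refine tendsto_of_tendsto_of_tendsto_of_le_of_le tendsto_const_nhds ?_
    (fun n => le_roundUp n h) (fun n => roundUp_le_add n N t)
  have : Tendsto (fun n : ℕ => t + 1 / ((n : ℝ≥0) + 1)) atTop (𝓝 (t + 0)) :=
    tendsto_const_nhds.add (tendsto_one_div_add_atTop_nhds_zero_nat)
  simpa using this

/-- Before the cap `N`, the rounded time is at most `i` iff `τ` is strictly below the last grid
point not exceeding `i`, an event known by time `i`. The inequality is strict because rounding
always moves to the next grid point. -/
theorem isStoppingTime_roundUp {τ : Ω → ℝ≥0} (hτ : IsStoppingTime ℱ fun ω => (τ ω : WithTop ℝ≥0))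
    (n : ℕ) (N : ℝ≥0) :
    IsStoppingTime ℱ fun ω => (roundUp n N (τ ω) : WithTop ℝ≥0) := by
  have hpos : (0 : ℝ≥0) < (n : ℝ≥0) + 1 := by positivity
  intro i
  by_cases hi : N ≤ i
  · convert MeasurableSet.univ
    exact eq_univ_of_forall fun ω =>
      WithTop.coe_le_coe.mpr ((min_le_right _ _).trans hi)
  have hle : ((⌊(n + 1) * i⌋₊ : ℝ≥0) / (n + 1)) ≤ i := by
    rw [div_le_iff₀ hpos, mul_comm]
    exact Nat.floor_le (by positivity)
  have : {ω | (roundUp n N (τ ω) : WithTop ℝ≥0) ≤ i} =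
      {ω | (τ ω : WithTop ℝ≥0) < ((⌊(n + 1) * i⌋₊ : ℝ≥0) / (n + 1) : ℝ≥0)} := by
    ext ω
    simp only [mem_ofPred_eq, WithTop.coe_le_coe, WithTop.coe_lt_coe, roundUp, min_le_iff, hi,
      or_false]
    rw [div_le_iff₀ hpos, lt_div_iff₀ hpos, mul_comm i, mul_comm (τ ω),
      ← Nat.floor_lt (by positivity)]
    have h1 : ((⌊(n + 1) * τ ω⌋₊ : ℝ≥0) + 1) = ((⌊(n + 1) * τ ω⌋₊ + 1 : ℕ) : ℝ≥0) := by push_cast; rfl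
    rw [h1, ← Nat.le_floor_iff (by positivity), Nat.succ_le_iff]
  rw [this]
  exact ℱ.mono hle _ (hτ.measurableSet_lt _)

/-- **Optional stopping** for a continuous martingale and a bounded stopping time. -/
theorem Martingale.integrable_and_setIntegral_stoppedValue (hf : Martingale f ℱ μ)
    (hc : ∀ ω, Continuous fun t => f t ω) {τ : Ω → WithTop ℝ≥0} (hτ : IsStoppingTime ℱ τ)
    {N : ℝ≥0} (hN : ∀ ω, τ ω ≤ N) :
    Integrable (stoppedValue f τ) μ ∧ ∀ A, MeasurableSet[hτ.measurableSpace] A →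
      ∫ ω in A, stoppedValue f τ ω ∂μ = ∫ ω in A, f N ω ∂μ := by
  have htop : ∀ ω, τ ω ≠ ⊤ := fun ω => ne_top_of_le_ne_top WithTop.coe_ne_top (hN ω)
  obtain ⟨τ, rfl⟩ : ∃ τ' : Ω → ℝ≥0, τ = fun ω => (τ' ω : WithTop ℝ≥0) :=
    ⟨fun ω => (τ ω).untop (htop ω), by simp⟩
  have hN' : ∀ ω, τ ω ≤ N := fun ω => WithTop.coe_le_coe.mp (hN ω)
  -- Approximation from above by times with countably many values, for which optional stopping is
  -- already known.
  let σ : ℕ → Ω → WithTop ℝ≥0 := fun n ω => (roundUp n N (τ ω) : WithTop ℝ≥0)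
  have hσ : ∀ n, IsStoppingTime ℱ (σ n) := fun n => isStoppingTime_roundUp hτ n N
  have hσN : ∀ n ω, σ n ω ≤ N := fun n ω => WithTop.coe_le_coe.mpr (min_le_right _ _)
  have hcount : ∀ n, (range (σ n)).Countable := by
    intro n
    refine (countable_range fun k : ℕ =>
      ((min (((k : ℝ≥0) + 1) / (n + 1)) N : ℝ≥0) : WithTop ℝ≥0)).mono ?_
    rintro _ ⟨ω, rfl⟩
    exact ⟨⌊(n + 1) * τ ω⌋₊, rfl⟩
  have hcond : ∀ n, stoppedValue f (σ n) =ᵐ[μ] μ[f N | (hσ n).measurableSpace] := fun n =>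
    hf.stoppedValue_ae_eq_condExp_of_le_const_of_countable_range (hσ n) (hσN n) (hcount n)
  have hint : ∀ n, Integrable (stoppedValue f (σ n)) μ := fun n =>
    integrable_condExp.congr (hcond n).symm
  have hlim : ∀ ω, Tendsto (fun n => stoppedValue f (σ n) ω) atTop
      (𝓝 (stoppedValue f (fun ω => (τ ω : WithTop ℝ≥0)) ω)) := fun ω =>
    ((hc ω).tendsto (τ ω)).comp (tendsto_roundUp (hN' ω))
  -- All the approximating values are conditional expectations of the single integrable variable `f
  -- N`, hence uniformly integrable. Pointwise convergence therefore gives convergence in L¹.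
  have hUI : UniformIntegrable (fun n => stoppedValue f (σ n)) 1 μ :=
    ((hf.integrable N).uniformIntegrable_condExp fun n => (hσ n).measurableSpace_le).ae_eq
      fun n => (hcond n).symm
  have hmem : MemLp (stoppedValue f (fun ω => (τ ω : WithTop ℝ≥0))) 1 μ :=
    hUI.memLp_of_ae_tendsto (ae_of_all _ hlim)
  have hL1 := tendsto_Lp_finite_of_tendsto_ae le_rfl ENNReal.one_ne_top
    (fun n => (hint n).aestronglyMeasurable) hmem hUI.unifIntegrable (ae_of_all _ hlim)
  refine ⟨memLp_one_iff_integrable.mp hmem, fun A hA => ?_⟩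
  have hAm : MeasurableSet A := hτ.measurableSpace_le _ hA
  refine tendsto_nhds_unique (tendsto_setIntegral_of_L1' _ hmem.aestronglyMeasurable
    (Eventually.of_forall hint) hL1 A) ?_
  refine tendsto_const_nhds.congr fun n => ?_
  have hAn : MeasurableSet[(hσ n).measurableSpace] A :=
    hτ.measurableSpace_mono (hσ n)
      (fun ω => WithTop.coe_le_coe.mpr (le_roundUp n (hN' ω))) _ hA
  rw [setIntegral_congr_ae hAm ((hcond n).mono fun ω h _ => h)]
  exact (setIntegral_condExp (hσ n).measurableSpace_le (hf.integrable N) hAn).symm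

end OptionalStopping

/-! ### The game state as a martingale and its exit from the unit interval. -/

section BrownianMotion

variable {Ω : Type*} {m : MeasurableSpace Ω} {μ : Measure Ω}
  {ℱ : Filtration ℝ≥0 m} {W : ℝ≥0 → Ω → ℝ} {x : ℝ}

namespace IsBrownianMotion

theorem continuous_state (hW : IsBrownianMotion W ℱ μ) (x : ℝ) (ω : Ω) :
    Continuous fun t => state W x t ω :=
  continuous_const.add (hW.continuous_paths ω)

theorem adapted_state (hW : IsBrownianMotion W ℱ μ) (x : ℝ) : Adapted ℱ (state W x) :=
  fun i => (hW.adapted i).const_add x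

theorem isStronglyProgressive_state (hW : IsBrownianMotion W ℱ μ) (x : ℝ) :
    IsStronglyProgressive ℱ (state W x) :=
  isStronglyProgressive_of_adapted (hW.adapted_state x) (hW.continuous_state x)

theorem martingale [IsProbabilityMeasure μ] (hW : IsBrownianMotion W ℱ μ) : Martingale W ℱ μ := by
  have hint := hW.isPreBrownian.integrable_eval
  refine ⟨fun i => (hW.adapted i).stronglyMeasurable, fun s t hst => ?_⟩
  have hsub : μ[fun ω => W t ω - W s ω | ℱ s] =ᵐ[μ] fun _ => 0 := by
    have h := condExp_indep_eq (μ := μ)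
      (m₁ := MeasurableSpace.comap (fun ω => W t ω - W s ω) inferInstance) (m₂ := ℱ s)
      (f := fun ω => W t ω - W s ω) ?_ (ℱ.le s)
      (comap_measurable _).stronglyMeasurable (hW.indep_increments s t hst)
    · refine h.trans (ae_of_all _ fun _ => ?_)
      dsimp only
      rw [integral_sub (hint t) (hint s), hW.isPreBrownian.integral_eval,
        hW.isPreBrownian.integral_eval, sub_zero]
    · exact measurable_iff_comap_le.mp
        ((((hW.adapted t).mono (ℱ.le t) le_rfl)).sub ((hW.adapted s).mono (ℱ.le s) le_rfl))
  have hs : μ[W s | ℱ s] = W s :=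
    condExp_of_stronglyMeasurable (ℱ.le s) (hW.adapted s).stronglyMeasurable (hint s)
  have hadd := condExp_sub (hint t) (hint s) (ℱ s)
  filter_upwards [hsub, hadd] with ω h1 h2
  have h3 : μ[W t - W s | ℱ s] ω = 0 := h1
  rw [h3, Pi.sub_apply, hs] at h2
  linarith

theorem martingale_state [IsProbabilityMeasure μ] (hW : IsBrownianMotion W ℱ μ) (x : ℝ) : Martingale (state W x) ℱ μ :=
  (martingale_const ℱ μ x).add hW.martingale

theorem ae_state_zero (hW : IsBrownianMotion W ℱ μ) (x : ℝ) : ∀ᵐ ω ∂μ, state W x 0 ω = x := by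
  filter_upwards [hW.isPreBrownian.eval_zero_ae_eq_zero] with ω h
  simp [state, h]

end IsBrownianMotion

/-- The first time at which the game state is not in `(0, 1)`. -/
noncomputable def exitTime (W : ℝ≥0 → Ω → ℝ) (x : ℝ) (ω : Ω) : WithTop ℝ≥0 :=
  hittingAfter (state W x) (Ioo 0 1)ᶜ 0 ω

theorem isClosed_compl_Ioo : IsClosed (Ioo (0 : ℝ) 1)ᶜ := isOpen_Ioo.isClosed_compl

theorem isStoppingTime_exitTime (hW : IsBrownianMotion W ℱ μ) (x : ℝ) :
    IsStoppingTime ℱ (exitTime W x) :=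
  isStoppingTime_timeAfter_hittingAfter (hW.adapted_state x) (hW.continuous_state x)
    isClosed_compl_Ioo ⟨0, by simp⟩ (isStoppingTime_const ℱ 0)

/-- `Live` only constrains times strictly before `t`, which is why a proposal at the exit time
itself still counts. -/
theorem live_iff (hW : IsBrownianMotion W ℱ μ) {t : ℝ≥0} {ω : Ω} :
    Live W x t ω ↔ (t : WithTop ℝ≥0) ≤ exitTime W x ω := by
  constructor
  · intro h
    obtain hT | ⟨s, hT⟩ := eq_top_or_eq_coe (exitTime W x ω)
    · rw [hT]; exact le_top
    · rw [hT]
      by_contra! hlt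
      exact (mem_of_hittingAfter_eq (hW.continuous_state x ω) isClosed_compl_Ioo hT).2
        (h s (WithTop.coe_lt_coe.mp hlt))
  · intro h s hs
    by_contra hmem
    exact notMem_of_lt_hittingAfter (n := 0)
      (lt_of_lt_of_le (WithTop.coe_lt_coe.mpr hs) h) zero_le hmem

/-- For a positive exit time the state is a limit from the left of points of (0, 1), so it lies in
[0, 1] but not in (0, 1). At exit time 0 the hypothesis on the initial state replaces this argument.
-/
theorem state_exitTime (hW : IsBrownianMotion W ℱ μ) {ω : Ω} {t : ℝ≥0}
    (h0 : state W x 0 ω ∈ Icc (0 : ℝ) 1) (h : exitTime W x ω = t) :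
    state W x t ω = 0 ∨ state W x t ω = 1 := by
  have hmem := (mem_of_hittingAfter_eq (hW.continuous_state x ω) isClosed_compl_Ioo h).2
  have hlive := (live_iff (x := x) hW).mpr h.ge
  rcases eq_or_ne t 0 with rfl | ht
  · by_contra! hne
    exact hmem ⟨lt_of_le_of_ne h0.1 hne.1.symm, lt_of_le_of_ne h0.2 hne.2⟩
  have hcl : state W x t ω ∈ Icc (0 : ℝ) 1 := by
    have hcw : ContinuousWithinAt (fun s => state W x s ω) (Iio t) t :=
      (hW.continuous_state x ω).continuousWithinAt
    have : t ∈ closure (Iio t) := by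
      rw [closure_Iio' ⟨0, pos_iff_ne_zero.mpr ht⟩]; exact self_mem_Iic
    have h2 := hcw.mem_closure this (t := Ioo 0 1) fun s hs => hlive s hs
    rwa [closure_Ioo zero_ne_one] at h2
  by_contra! hne
  exact hmem ⟨lt_of_le_of_ne hcl.1 hne.1.symm, lt_of_le_of_ne hcl.2 hne.2⟩

theorem state_mem_Icc (hW : IsBrownianMotion W ℱ μ) {ω : Ω} {t : ℝ≥0}
    (h0 : state W x 0 ω ∈ Icc (0 : ℝ) 1) (h : (t : WithTop ℝ≥0) ≤ exitTime W x ω) :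
    state W x t ω ∈ Icc (0 : ℝ) 1 := by
  rcases h.eq_or_lt with h | h
  · rcases state_exitTime hW h0 h.symm with h | h <;> simp [h]
  · have := notMem_of_lt_hittingAfter (n := 0) h zero_le
    exact Ioo_subset_Icc_self (not_not.mp this)

theorem measure_gaussianReal_Ioo_le (a : ℝ) {v : ℝ≥0} (hv : v ≠ 0) :
    gaussianReal 0 v (Ioo a (a + 1)) ≤ ENNReal.ofReal (√(2 * Real.pi * v))⁻¹ := by
  rw [gaussianReal_apply 0 hv]
  calc ∫⁻ y in Ioo a (a + 1), gaussianPDF 0 v y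
      ≤ ∫⁻ y in Ioo a (a + 1), ENNReal.ofReal (√(2 * Real.pi * v))⁻¹ := by
        refine lintegral_mono fun y => ENNReal.ofReal_le_ofReal ?_
        rw [gaussianPDFReal]
        refine mul_le_of_le_one_right (by positivity) (Real.exp_le_one_iff.mpr ?_)
        rw [neg_div]
        exact neg_nonpos.mpr (by positivity)
    _ = ENNReal.ofReal (√(2 * Real.pi * v))⁻¹ := by simp

/-- The game ends almost surely. -/
theorem ae_exitTime_ne_top (hW : IsBrownianMotion W ℱ μ) (x : ℝ) :
    ∀ᵐ ω ∂μ, exitTime W x ω ≠ ⊤ := by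
  -- If the state never leaves (0, 1), the motion at time n + 1 lies in an interval of length 1.
  -- That probability is at most the maximum of the Gaussian density, which tends to 0.
  have hle : ∀ n : ℕ, μ {ω | exitTime W x ω = ⊤} ≤
      ENNReal.ofReal (√(2 * Real.pi * ((n + 1 : ℕ) : ℝ≥0)))⁻¹ := by
    intro n
    have hlaw := hW.isPreBrownian.hasLaw_eval ((n + 1 : ℕ) : ℝ≥0)
    refine le_trans ?_ (measure_gaussianReal_Ioo_le (-x) (v := ((n + 1 : ℕ) : ℝ≥0))
      (by exact_mod_cast n.succ_ne_zero))
    rw [← hlaw.map_eq, Measure.map_apply_of_aemeasurable hlaw.aemeasurable measurableSet_Ioo]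
    refine measure_mono fun ω hω => ?_
    have h1 := hittingAfter_eq_top_iff.mp hω ((n + 1 : ℕ) : ℝ≥0) zero_le
    obtain ⟨h2, h3⟩ := not_not.mp h1
    simp only [state] at h2 h3
    exact ⟨by linarith, by linarith⟩
  have hlim : Tendsto (fun n : ℕ => ENNReal.ofReal (√(2 * Real.pi * ((n + 1 : ℕ) : ℝ≥0)))⁻¹)
      atTop (𝓝 0) := by
    rw [← ENNReal.ofReal_zero]
    refine ENNReal.tendsto_ofReal (tendsto_inv_atTop_zero.comp ?_)
    refine Real.tendsto_sqrt_atTop.comp (Tendsto.const_mul_atTop (by positivity) ?_)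
    refine (tendsto_natCast_atTop_atTop.comp (tendsto_add_atTop_nat 1)).congr fun n => by simp
  have h0 := ge_of_tendsto' hlim hle
  rw [ae_iff]
  simpa using h0

end BrownianMotion

/-! ### Symmetry between the two players. -/

namespace Player

@[simp] theorem opp_opp (P : Player) : P.opp.opp = P := by cases P <;> rfl

theorem opp_ne (P : Player) : P.opp ≠ P := by cases P <;> simp [opp]

theorem eq_or_eq_opp (P Q : Player) : Q = P ∨ Q = P.opp := by cases P <;> cases Q <;> simp [opp]

theorem sign_opp (P : Player) : P.opp.sign = -P.sign := by cases P <;> simp [opp, sign]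

@[simp] theorem sign_mul_sign (P : Player) : P.sign * P.sign = 1 := by cases P <;> simp [sign]

theorem view_opp (P : Player) (p : ℝ) : P.opp.view p = 1 - P.view p := by
  cases P <;> simp [opp, view]

theorem sign_mul_sub (P : Player) (p : ℝ) : P.sign * (2 * p - 1) = 2 * P.view p - 1 := by
  cases P <;> simp [sign, view]; ring

theorem view_mem_Icc (P : Player) {p : ℝ} (hp : p ∈ Icc (0 : ℝ) 1) : P.view p ∈ Icc (0 : ℝ) 1 := by
  obtain ⟨h0, h1⟩ := hp
  cases P
  · exact ⟨h0, h1⟩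
  · exact ⟨by simp only [view]; linarith, by simp only [view]; linarith⟩

theorem continuous_view (P : Player) : Continuous P.view := by
  cases P
  · exact continuous_id
  · exact continuous_const.sub continuous_id

end Player

/-! ### Optional stopping from an arbitrary position of the game. -/

section Position

variable {Ω : Type*} {m : MeasurableSpace Ω} {μ : Measure Ω} {ℱ : Filtration ℝ≥0 m}
  {W : ℝ≥0 → Ω → ℝ} {x : ℝ} {ρ θ : Ω → WithTop ℝ≥0} {A : Set Ω}

theorem stoppedValue_of_eq {f : ℝ≥0 → Ω → ℝ} {ω : Ω} {t : ℝ≥0} (h : ρ ω = t) :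
    stoppedValue f ρ ω = f t ω := by
  rw [stoppedValue, h]; rfl

/-- The subjective game state of a player at a random time. -/
noncomputable def viewAt (W : ℝ≥0 → Ω → ℝ) (x : ℝ) (P : Player) (ρ : Ω → WithTop ℝ≥0) (ω : Ω) :
    ℝ :=
  P.view (stoppedValue (state W x) ρ ω)

theorem viewAt_of_eq {P : Player} {ω : Ω} {t : ℝ≥0} (h : ρ ω = t) :
    viewAt W x P ρ ω = P.view (state W x t ω) := by
  rw [viewAt, stoppedValue_of_eq h]

theorem viewAt_congr {P : Player} {ω : Ω} (h : ρ ω = θ ω) :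
    viewAt W x P ρ ω = viewAt W x P θ ω := by
  simp only [viewAt, stoppedValue, h]

theorem viewAt_opp (P : Player) (ω : Ω) : viewAt W x P.opp ρ ω = 1 - viewAt W x P ρ ω :=
  P.view_opp _

/-- An event `A` that is known at the stopping time `ρ` and on which the game is not over before
that time. -/
structure IsPosition (ℱ : Filtration ℝ≥0 m) (W : ℝ≥0 → Ω → ℝ) (x : ℝ) (ρ : Ω → WithTop ℝ≥0)
    (A : Set Ω) : Prop where
  isStoppingTime : IsStoppingTime ℱ ρ
  measurableSet : MeasurableSet[isStoppingTime.measurableSpace] A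
  ne_top : ∀ ω ∈ A, ρ ω ≠ ⊤
  le_exitTime : ∀ ω ∈ A, ρ ω ≤ exitTime W x ω

namespace IsPosition

theorem measurableSet' (h : IsPosition ℱ W x ρ A) : MeasurableSet A :=
  h.isStoppingTime.measurableSpace_le _ h.measurableSet

theorem inter (h : IsPosition ℱ W x ρ A) {B : Set Ω}
    (hB : MeasurableSet[h.isStoppingTime.measurableSpace] B) : IsPosition ℱ W x ρ (A ∩ B) :=
  ⟨h.isStoppingTime, h.measurableSet.inter hB, fun ω hω => h.ne_top ω hω.1,
    fun ω hω => h.le_exitTime ω hω.1⟩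

theorem diff (h : IsPosition ℱ W x ρ A) {B : Set Ω}
    (hB : MeasurableSet[h.isStoppingTime.measurableSpace] B) : IsPosition ℱ W x ρ (A \ B) :=
  h.inter hB.compl

end IsPosition

theorem isPosition_zero : IsPosition ℱ W x (fun _ => ((0 : ℝ≥0) : WithTop ℝ≥0)) univ :=
  ⟨isStoppingTime_const ℱ 0, MeasurableSet.univ, fun _ _ => WithTop.coe_ne_top,
    fun ω _ => le_hittingAfter ω⟩

/-- The event that a proposal made at time `τ` comes before the end of the game. -/
def counted (W : ℝ≥0 → Ω → ℝ) (x : ℝ) (τ : Ω → WithTop ℝ≥0) : Set Ω :=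
  {ω | τ ω ≠ ⊤ ∧ τ ω ≤ exitTime W x ω}

theorem measurableSet_counted (hW : IsBrownianMotion W ℱ μ) (x : ℝ) {τ : Ω → WithTop ℝ≥0}
    (hτ : IsStoppingTime ℱ τ) : MeasurableSet[hτ.measurableSpace] (counted W x τ) :=
  ((measurableSet_singleton _).preimage hτ.measurable).compl.inter
    (hτ.measurableSet_le_stopping_time (isStoppingTime_exitTime hW x))

theorem isPosition_inter_counted (hW : IsBrownianMotion W ℱ μ) {τ : Ω → WithTop ℝ≥0}
    (hτ : IsStoppingTime ℱ τ) (hA : MeasurableSet[hτ.measurableSpace] A) :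
    IsPosition ℱ W x τ (A ∩ counted W x τ) :=
  ⟨hτ, hA.inter (measurableSet_counted hW x hτ), fun _ h => h.2.1, fun _ h => h.2.2⟩

theorem ae_regular (hW : IsBrownianMotion W ℱ μ) (x : ℝ) :
    ∀ᵐ ω ∂μ, state W x 0 ω = x ∧ exitTime W x ω ≠ ⊤ :=
  (hW.ae_state_zero x).and (ae_exitTime_ne_top hW x)

theorem viewAt_mem_Icc (hW : IsBrownianMotion W ℱ μ) (hx : x ∈ Icc (0 : ℝ) 1) (P : Player) {ω : Ω}
    (hω : state W x 0 ω = x ∧ exitTime W x ω ≠ ⊤) (h : ρ ω ≤ exitTime W x ω) :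
    viewAt W x P ρ ω ∈ Icc (0 : ℝ) 1 := by
  obtain ⟨t, ht⟩ := WithTop.ne_top_iff_exists.mp (ne_top_of_le_ne_top hω.2 h)
  rw [viewAt_of_eq ht.symm]
  exact P.view_mem_Icc (state_mem_Icc hW (by rw [hω.1]; exact hx) (ht ▸ h))

theorem measurable_viewAt (hW : IsBrownianMotion W ℱ μ) (P : Player) (hρ : IsStoppingTime ℱ ρ) :
    Measurable[hρ.measurableSpace] (viewAt W x P ρ) :=
  P.continuous_view.measurable.comp
    (measurable_stoppedValue (hW.isStronglyProgressive_state x) hρ)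

theorem integrableOn_comp_viewAt [IsProbabilityMeasure μ] (hW : IsBrownianMotion W ℱ μ)
    (hx : x ∈ Icc (0 : ℝ) 1)
    (P : Player) {f : ℝ → ℝ} (hf : Continuous f) (hθ : IsStoppingTime ℱ θ) (hA : MeasurableSet A)
    (h : ∀ ω ∈ A, θ ω ≤ exitTime W x ω) : IntegrableOn (fun ω => f (viewAt W x P θ ω)) A μ := by
  obtain ⟨C, hC⟩ := isCompact_Icc.exists_bound_of_continuousOn (hf.continuousOn (s := Icc 0 1))
  refine Measure.integrableOn_of_bounded (measure_ne_top μ A) (M := C)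
    (hf.measurable.comp ((measurable_viewAt hW P hθ).mono
      hθ.measurableSpace_le le_rfl)).aestronglyMeasurable ?_
  rw [ae_restrict_iff' hA]
  filter_upwards [ae_regular hW x] with ω hω hA
  exact hC _ (viewAt_mem_Icc hW hx P hω (h ω hA))

/-- Removes the bound on the stopping times needed in optional stopping. The game ends almost surely
and the state stays in [0, 1] until then, so dominated convergence applies. The restriction to `ρ ω
≤ N` gives an event already known at the truncated time. -/
theorem tendsto_setIntegral_min_const [IsProbabilityMeasure μ] (hW : IsBrownianMotion W ℱ μ)
    (hx : x ∈ Icc (0 : ℝ) 1) (hA : IsPosition ℱ W x ρ A)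
    (hθ : IsStoppingTime ℱ θ) (h : ∀ ω ∈ A, ρ ω ≤ θ ω ∧ θ ω ≤ exitTime W x ω) :
    Tendsto (fun N : ℕ => ∫ ω in A ∩ {ω | ρ ω ≤ ((N : ℝ≥0) : WithTop ℝ≥0)},
        stoppedValue (state W x) (fun ω => min (θ ω) ((N : ℝ≥0) : WithTop ℝ≥0)) ω ∂μ) atTop
      (𝓝 (∫ ω in A, stoppedValue (state W x) θ ω ∂μ)) := by
  have hAm := hA.measurableSet'
  have hAN : ∀ N : ℕ, MeasurableSet (A ∩ {ω | ρ ω ≤ ((N : ℝ≥0) : WithTop ℝ≥0)}) := fun N =>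
    hAm.inter (ℱ.le _ _ (hA.isStoppingTime N))
  simp only [← integral_indicator (hAN _)]
  rw [← integral_indicator hAm]
  refine tendsto_integral_of_dominated_convergence (fun _ => 1) (fun N => ?_)
    (integrable_const _) (fun N => ?_) ?_
  · exact (((measurable_stoppedValue (hW.isStronglyProgressive_state x)
      (hθ.min_const N)).mono (hθ.min_const N).measurableSpace_le le_rfl).indicator
        (hAN N)).aestronglyMeasurable
  · filter_upwards [ae_regular hW x] with ω hω
    by_cases hm : ω ∈ A ∩ {ω | ρ ω ≤ ((N : ℝ≥0) : WithTop ℝ≥0)}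
    · rw [indicator_of_mem hm, Real.norm_eq_abs]
      have := viewAt_mem_Icc hW hx Player.A (ρ := fun ω => min (θ ω) ((N : ℝ≥0) : WithTop ℝ≥0)) hω
        ((min_le_left _ _).trans (h ω hm.1).2)
      simp only [viewAt, Player.view] at this
      exact abs_le.mpr ⟨by linarith [this.1], this.2⟩
    · rw [indicator_of_notMem hm]; simp
  · filter_upwards [ae_regular hW x] with ω hω
    by_cases hm : ω ∈ A
    · obtain ⟨t, ht⟩ := WithTop.ne_top_iff_exists.mp (ne_top_of_le_ne_top hω.2 (h ω hm).2)
      obtain ⟨n, hn⟩ := exists_nat_ge t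
      refine tendsto_const_nhds.congr' ?_
      filter_upwards [eventually_ge_atTop n] with N hN
      have htN : θ ω ≤ ((N : ℝ≥0) : WithTop ℝ≥0) := by
        rw [← ht]
        exact WithTop.coe_le_coe.mpr (hn.trans (by exact_mod_cast hN))
      have hmN : ω ∈ A ∩ {ω | ρ ω ≤ ((N : ℝ≥0) : WithTop ℝ≥0)} := ⟨hm, (h ω hm).1.trans htN⟩
      rw [indicator_of_mem hm, indicator_of_mem hmN]
      simp only [stoppedValue, min_eq_left htN]
    · rw [indicator_of_notMem hm]
      refine tendsto_const_nhds.congr fun N => ?_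
      rw [indicator_of_notMem fun h => hm h.1]

/-- Optional stopping for the game state. -/
theorem setIntegral_stoppedValue_state [IsProbabilityMeasure μ] (hW : IsBrownianMotion W ℱ μ)
    (hx : x ∈ Icc (0 : ℝ) 1) (hA : IsPosition ℱ W x ρ A)
    (hθ : IsStoppingTime ℱ θ) (h : ∀ ω ∈ A, ρ ω ≤ θ ω ∧ θ ω ≤ exitTime W x ω) :
    ∫ ω in A, stoppedValue (state W x) θ ω ∂μ = ∫ ω in A, stoppedValue (state W x) ρ ω ∂μ := by
  have hρ := hA.isStoppingTime
  -- `θ` is above `ρ` only on `A`. The maximum is above `ρ` everywhere, so everything known at `ρ`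
  -- is known at it, and on `A` nothing changes.
  have hmax : ∀ ω ∈ A, max (ρ ω) (θ ω) = θ ω := fun ω hω => max_eq_right (h ω hω).1
  have h1 := tendsto_setIntegral_min_const hW hx hA (hρ.max hθ)
    fun ω hω => by rw [hmax ω hω]; exact h ω hω
  have h2 := tendsto_setIntegral_min_const hW hx hA hρ fun ω hω => ⟨le_rfl, hA.le_exitTime ω hω⟩
  have h3 : ∫ ω in A, stoppedValue (state W x) (fun ω => max (ρ ω) (θ ω)) ω ∂μ =
      ∫ ω in A, stoppedValue (state W x) θ ω ∂μ :=
    setIntegral_congr_fun hA.measurableSet' fun ω hω => by simp only [stoppedValue, hmax ω hω]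
  rw [h3] at h1
  refine tendsto_nhds_unique h1 (h2.congr fun N => ?_)
  have hAN := (hρ.measurableSet_inter_le_const_iff A (N : ℝ≥0)).mp
    (hA.measurableSet.inter (hρ.measurableSet_le' (N : ℝ≥0)))
  have hmart := hW.martingale_state (μ := μ) x
  rw [(Martingale.integrable_and_setIntegral_stoppedValue hmart (hW.continuous_state x)
      (hρ.min_const (N : ℝ≥0)) fun _ => min_le_right _ _).2 _ hAN,
    (Martingale.integrable_and_setIntegral_stoppedValue hmart (hW.continuous_state x)
      ((hρ.max hθ).min_const (N : ℝ≥0)) fun _ => min_le_right _ _).2 _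
      ((hρ.min_const _).measurableSpace_mono ((hρ.max hθ).min_const _)
        (fun ω => min_le_min_right _ (le_max_left _ _)) _ hAN)]

theorem setIntegral_viewAt_affine [IsProbabilityMeasure μ] (hW : IsBrownianMotion W ℱ μ)
    (hx : x ∈ Icc (0 : ℝ) 1) (hA : IsPosition ℱ W x ρ A)
    (hθ : IsStoppingTime ℱ θ) (h : ∀ ω ∈ A, ρ ω ≤ θ ω ∧ θ ω ≤ exitTime W x ω) (P : Player)
    (a b : ℝ) :
    ∫ ω in A, (a + b * viewAt W x P θ ω) ∂μ = ∫ ω in A, (a + b * viewAt W x P ρ ω) ∂μ := by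
  obtain ⟨a', b', hab⟩ : ∃ a' b' : ℝ, ∀ p, a + b * P.view p = a' + b' * p := by
    cases P
    · exact ⟨a, b, fun p => rfl⟩
    · exact ⟨a + b, -b, fun p => by simp only [Player.view]; ring⟩
  have hint : ∀ σ : Ω → WithTop ℝ≥0, IsStoppingTime ℱ σ → (∀ ω ∈ A, σ ω ≤ exitTime W x ω) →
      IntegrableOn (fun ω => stoppedValue (state W x) σ ω) A μ := fun σ hσ hle =>
    integrableOn_comp_viewAt hW hx Player.A continuous_id hσ hA.measurableSet' hle
  simp only [viewAt, hab]
  rw [integral_add (integrable_const _) ((hint θ hθ fun ω hω => (h ω hω).2).const_mul _),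
    integral_add (integrable_const _) ((hint ρ hA.isStoppingTime hA.le_exitTime).const_mul _),
    integral_const_mul, integral_const_mul, setIntegral_stoppedValue_state hW hx hA hθ h]

/-- Optional stopping for a truncated affine function of the game state. -/
theorem setIntegral_min_viewAt_le [IsProbabilityMeasure μ] (hW : IsBrownianMotion W ℱ μ)
    (hx : x ∈ Icc (0 : ℝ) 1) (hA : IsPosition ℱ W x ρ A)
    (hθ : IsStoppingTime ℱ θ) (h : ∀ ω ∈ A, ρ ω ≤ θ ω ∧ θ ω ≤ exitTime W x ω) (P : Player)
    (a b : ℝ) :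
    ∫ ω in A, min 1 (a + b * viewAt W x P θ ω) ∂μ ≤
      ∫ ω in A, min 1 (a + b * viewAt W x P ρ ω) ∂μ := by
  have hρ := hA.isStoppingTime
  -- Where the truncation is inactive at `ρ` the affine function has constant expectation and
  -- truncating at `θ` only lowers it. Elsewhere the value at `ρ` is already the maximum 1.
  let B : Set Ω := {ω | a + b * viewAt W x P ρ ω ≤ 1}
  have hB : MeasurableSet[hρ.measurableSpace] B :=
    measurableSet_le (((measurable_viewAt hW P hρ).const_mul b).const_add a) measurable_const
  have hBm : MeasurableSet B := hρ.measurableSpace_le _ hB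
  have hAm := hA.measurableSet'
  have hcont : Continuous fun p : ℝ => min 1 (a + b * p) := by fun_prop
  have hcont' : Continuous fun p : ℝ => a + b * p := by fun_prop
  have hle : ∀ ω ∈ A, θ ω ≤ exitTime W x ω := fun ω hω => (h ω hω).2
  have hi1 := integrableOn_comp_viewAt hW hx P hcont hθ hAm hle
  have hi2 := integrableOn_comp_viewAt hW hx P hcont hρ hAm hA.le_exitTime
  have hi3 := integrableOn_comp_viewAt hW hx P hcont' hθ hAm hle
  rw [← integral_inter_add_sdiff hBm hi1, ← integral_inter_add_sdiff hBm hi2]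
  refine add_le_add ?_ ?_
  · calc _ ≤ ∫ ω in A ∩ B, (a + b * viewAt W x P θ ω) ∂μ :=
          setIntegral_mono (hi1.mono_set inter_subset_left) (hi3.mono_set inter_subset_left)
            fun ω => min_le_right _ _
      _ = ∫ ω in A ∩ B, (a + b * viewAt W x P ρ ω) ∂μ :=
          setIntegral_viewAt_affine hW hx (hA.inter hB) hθ (fun ω hω => h ω hω.1) P a b
      _ = _ := setIntegral_congr_fun (hAm.inter hBm) fun ω hω => (min_eq_right hω.2).symm
  · refine setIntegral_mono_on (hi1.mono_set sdiff_subset) (hi2.mono_set sdiff_subset)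
      (hAm.diff hBm) fun ω hω => ?_
    have : 1 ≤ a + b * viewAt W x P ρ ω := (not_le.mp hω.2).le
    rw [min_eq_left this]
    exact min_le_left _ _

/-- Without further doubles the expected payoff is determined by the game state. -/
theorem ae_outcome (hW : IsBrownianMotion W ℱ μ) (hx : x ∈ Icc (0 : ℝ) 1) :
    ∀ᵐ ω ∂μ, outcome W x ω = 2 * stoppedValue (state W x) (exitTime W x) ω - 1 := by
  filter_upwards [ae_regular hW x] with ω hω
  obtain ⟨t, ht⟩ := WithTop.ne_top_iff_exists.mp hω.2
  rw [stoppedValue_of_eq ht.symm]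
  have hlive : Live W x t ω := (live_iff hW).mpr ht.le
  have huniq : ∀ s, Live W x s ω → state W x s ω ∉ Ioo (0 : ℝ) 1 → s = t := by
    intro s hs hmem
    have hst : s ≤ t := WithTop.coe_le_coe.mp (ht ▸ (live_iff hW).mp hs)
    by_contra hne
    exact hmem (hlive s (lt_of_le_of_ne hst hne))
  rcases state_exitTime hW (by rw [hω.1]; exact hx) ht.symm with h | h
  · have hno : ¬ ∃ s, Live W x s ω ∧ state W x s ω = 1 := by
      rintro ⟨s, hs, h1⟩
      rw [huniq s hs (by simp [h1]), h] at h1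
      exact zero_ne_one h1
    rw [outcome, if_neg hno, if_pos ⟨t, hlive, h⟩, h]
    norm_num
  · rw [outcome, if_pos ⟨t, hlive, h⟩, h]
    norm_num

theorem ae_sign_mul_outcome (hW : IsBrownianMotion W ℱ μ) (hx : x ∈ Icc (0 : ℝ) 1) (P : Player) :
    ∀ᵐ ω ∂μ, P.sign * outcome W x ω = 2 * viewAt W x P (exitTime W x) ω - 1 := by
  filter_upwards [ae_outcome hW hx] with ω h
  rw [h, P.sign_mul_sub]; rfl

theorem integrable_outcome [IsProbabilityMeasure μ] (hW : IsBrownianMotion W ℱ μ)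
    (hx : x ∈ Icc (0 : ℝ) 1) : Integrable (outcome W x) μ := by
  have := integrableOn_comp_viewAt hW hx Player.A (f := fun p => 2 * p - 1) (by fun_prop)
    (isStoppingTime_exitTime hW x) MeasurableSet.univ fun _ _ => le_rfl
  rw [integrableOn_univ] at this
  exact this.congr ((ae_outcome hW hx).mono fun ω h => h.symm)

end Position

/-! ### Threshold strategies and the decomposition of the payoff into stages. -/

section Strategies

variable {Ω : Type*} {m : MeasurableSpace Ω} {μ : Measure Ω} {ℱ : Filtration ℝ≥0 m}
  {W : ℝ≥0 → Ω → ℝ} {x : ℝ} {ρ θ : Ω → WithTop ℝ≥0} {A : Set Ω}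

theorem continuous_view_state (hW : IsBrownianMotion W ℱ μ) (x : ℝ) (P : Player) (ω : Ω) :
    Continuous fun u => P.view (state W x u ω) :=
  P.continuous_view.comp (hW.continuous_state x ω)

theorem adapted_view_state (hW : IsBrownianMotion W ℱ μ) (x : ℝ) (P : Player) :
    Adapted ℱ fun u ω => P.view (state W x u ω) :=
  fun i => P.continuous_view.measurable.comp (hW.adapted_state x i)

/-- The strategy of `P` that proposes and declines doubles according to the thresholds `d k`. -/
noncomputable def thresholdStrategy (hW : IsBrownianMotion W ℱ μ) (x : ℝ) (d : ℕ → ℝ)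
    (P : Player) : Strategy ℱ where
  propose k t ω := hittingAfter (fun u ω => P.view (state W x u ω)) (Ici (d k)) t ω
  fold k t := {ω | d k ≤ P.opp.view (state W x t ω)}
  le_propose k t ω := le_hittingAfter ω
  isStoppingTime_propose k ρ hρ :=
    isStoppingTime_timeAfter_hittingAfter (adapted_view_state hW x P)
      (continuous_view_state hW x P) isClosed_Ici nonempty_Ici hρ
  measurableSet_fold k ρ hρ := by
    have : {ω | ∃ t : ℝ≥0, ρ ω = t ∧ ω ∈ {ω | d k ≤ P.opp.view (state W x t ω)}} =
        {ω | ρ ω = ⊤}ᶜ ∩ {ω | d k ≤ viewAt W x P.opp ρ ω} := by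
      ext ω
      constructor
      · rintro ⟨t, ht, hd⟩
        refine ⟨fun h => WithTop.coe_ne_top (ht.symm.trans h), ?_⟩
        rw [mem_ofPred_eq, viewAt_of_eq ht]
        exact hd
      · rintro ⟨h1, h2⟩
        obtain ⟨t, ht⟩ := WithTop.ne_top_iff_exists.mp h1
        rw [mem_ofPred_eq, viewAt_of_eq ht.symm] at h2
        exact ⟨t, ht.symm, h2⟩
    rw [this]
    exact ((measurableSet_singleton _).preimage hρ.measurable).compl.inter
      (measurableSet_le measurable_const (measurable_viewAt hW P.opp hρ))

variable {σ : Player → Strategy ℱ} {P : Player} {k : ℕ}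

/-- Payoff to Player A, per unit of the current stake, when `P` proposes a double at time `t` and
`k` further doubles remain. -/
noncomputable def proposalPayoff (W : ℝ≥0 → Ω → ℝ) (x : ℝ) (σ : Player → Strategy ℱ) (k : ℕ)
    (P : Player) (t : ℝ≥0) (ω : Ω) : ℝ :=
  open Classical in
  if ω ∈ (σ P.opp).fold (k + 1) t then P.sign else 2 * soloPayoff W x σ k P.opp t ω

/-- The time of the next proposal of `P` if the right to double passes to `P` at time `ρ`. -/
noncomputable def proposalTime (σ : Player → Strategy ℱ) (k : ℕ) (P : Player)
    (ρ : Ω → WithTop ℝ≥0) : Ω → WithTop ℝ≥0 :=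
  timeAfter ((σ P).propose k) ρ

theorem isStoppingTime_proposalTime (σ : Player → Strategy ℱ) (k : ℕ) (P : Player)
    (hρ : IsStoppingTime ℱ ρ) : IsStoppingTime ℱ (proposalTime σ k P ρ) :=
  (σ P).isStoppingTime_propose k ρ hρ

theorem le_proposalTime (σ : Player → Strategy ℱ) (k : ℕ) (P : Player) (ρ : Ω → WithTop ℝ≥0) :
    ρ ≤ proposalTime σ k P ρ :=
  le_timeAfter ((σ P).le_propose k) ρ

/-- The event that a double proposed at time `ρ` by the opponent of `P` is declined. -/
def foldSet (σ : Player → Strategy ℱ) (k : ℕ) (P : Player) (ρ : Ω → WithTop ℝ≥0) : Set Ω :=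
  {ω | ∃ t : ℝ≥0, ρ ω = t ∧ ω ∈ (σ P).fold k t}

theorem measurableSet_foldSet (σ : Player → Strategy ℱ) (k : ℕ) (P : Player)
    (hρ : IsStoppingTime ℱ ρ) : MeasurableSet[hρ.measurableSpace] (foldSet σ k P ρ) :=
  (σ P).measurableSet_fold k ρ hρ

open Classical in
theorem stoppedValue_soloPayoff_succ (hW : IsBrownianMotion W ℱ μ) {ω : Ω} (h : ρ ω ≠ ⊤) :
    stoppedValue (soloPayoff W x σ (k + 1) P) ρ ω =
      if ω ∈ counted W x (proposalTime σ (k + 1) P ρ) then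
        stoppedValue (proposalPayoff W x σ k P) (proposalTime σ (k + 1) P ρ) ω
      else outcome W x ω := by
  obtain ⟨t, ht⟩ := WithTop.ne_top_iff_exists.mp h
  rw [stoppedValue_of_eq ht.symm, soloPayoff]
  have hτ : proposalTime σ (k + 1) P ρ ω = (σ P).propose (k + 1) t ω := timeAfter_of_eq ht.symm
  obtain hs | ⟨s, hs⟩ := eq_top_or_eq_coe ((σ P).propose (k + 1) t ω)
  · rw [if_neg fun h => h.1 hs, if_neg fun h => h.1 (hτ.trans hs)]
  · have hcond : (proposalTime σ (k + 1) P ρ ω ≠ ⊤ ∧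
        proposalTime σ (k + 1) P ρ ω ≤ exitTime W x ω) ↔
        ((σ P).propose (k + 1) t ω ≠ ⊤ ∧ Live W x (((σ P).propose (k + 1) t ω).untopD 0) ω) := by
      rw [hτ, hs, WithTop.untopD_coe, live_iff hW]
    simp only [counted, mem_ofPred_eq, hcond]
    rw [stoppedValue_of_eq (hτ.trans hs), hs, WithTop.untopD_coe]
    rfl

theorem stoppedValue_proposalPayoff_of_mem {ω : Ω} (h : ω ∈ foldSet σ (k + 1) P.opp ρ) :
    stoppedValue (proposalPayoff W x σ k P) ρ ω = P.sign := by
  obtain ⟨t, ht, hf⟩ := h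
  rw [stoppedValue_of_eq ht, proposalPayoff, if_pos hf]

theorem stoppedValue_proposalPayoff_of_notMem {ω : Ω} (hρ : ρ ω ≠ ⊤)
    (h : ω ∉ foldSet σ (k + 1) P.opp ρ) :
    stoppedValue (proposalPayoff W x σ k P) ρ ω =
      2 * stoppedValue (soloPayoff W x σ k P.opp) ρ ω := by
  obtain ⟨t, ht⟩ := WithTop.ne_top_iff_exists.mp hρ
  rw [stoppedValue_of_eq ht.symm, stoppedValue_of_eq ht.symm, proposalPayoff,
    if_neg fun hf => h ⟨t, ht.symm, hf⟩]

theorem isPosition_proposalTime (hW : IsBrownianMotion W ℱ μ) (σ : Player → Strategy ℱ) (k : ℕ)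
    (P : Player) (h : IsPosition ℱ W x ρ A) :
    IsPosition ℱ W x (proposalTime σ k P ρ) (A ∩ counted W x (proposalTime σ k P ρ)) :=
  isPosition_inter_counted hW (isStoppingTime_proposalTime σ k P h.isStoppingTime)
    (h.isStoppingTime.measurableSpace_mono (isStoppingTime_proposalTime σ k P h.isStoppingTime)
      (le_proposalTime σ k P ρ) _ h.measurableSet)

variable [IsProbabilityMeasure μ]

/-- The payoffs of a proposal and of a stage refer to each other; taking integrability of the next
stage as a hypothesis lets this be used inside the induction on `k`. -/
theorem integrableOn_proposalPayoff_of_soloPayoff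
    (ih : ∀ {B : Set Ω}, IsPosition ℱ W x ρ B →
      IntegrableOn (stoppedValue (soloPayoff W x σ k P.opp) ρ) B μ)
    (h : IsPosition ℱ W x ρ A) : IntegrableOn (stoppedValue (proposalPayoff W x σ k P) ρ) A μ := by
  have hf := measurableSet_foldSet σ (k + 1) P.opp h.isStoppingTime
  have h1 := h.inter hf
  have h2 := h.diff hf
  rw [← inter_union_sdiff A (foldSet σ (k + 1) P.opp ρ)]
  refine IntegrableOn.union ?_ ?_
  · exact (integrableOn_const (C := P.sign) (measure_ne_top μ _)).congr_fun
      (fun ω hω => (stoppedValue_proposalPayoff_of_mem hω.2).symm) h1.measurableSet'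
  · exact IntegrableOn.congr_fun ((ih h2).const_mul 2)
      (fun ω hω => (stoppedValue_proposalPayoff_of_notMem (h.ne_top ω hω.1) hω.2).symm)
      h2.measurableSet'

/-- `A` need not be known at `ρ`. Before the first double, play is split according to who proposes
first, and this is not known at time 0. -/
theorem integrableOn_soloPayoff_succ (hW : IsBrownianMotion W ℱ μ) (hx : x ∈ Icc (0 : ℝ) 1)
    (hA : MeasurableSet A) (hne : ∀ ω ∈ A, ρ ω ≠ ⊤)
    (hC : MeasurableSet (A ∩ counted W x (proposalTime σ (k + 1) P ρ)))
    (hint : IntegrableOn (stoppedValue (proposalPayoff W x σ k P) (proposalTime σ (k + 1) P ρ))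
      (A ∩ counted W x (proposalTime σ (k + 1) P ρ)) μ) :
    IntegrableOn (stoppedValue (soloPayoff W x σ (k + 1) P) ρ) A μ := by
  classical
  rw [← inter_union_sdiff A (counted W x (proposalTime σ (k + 1) P ρ))]
  refine IntegrableOn.union ?_ ?_
  · exact hint.congr_fun (fun ω hω => by
      rw [stoppedValue_soloPayoff_succ hW (hne ω hω.1), if_pos hω.2]) hC
  · refine (integrable_outcome hW hx).integrableOn.congr_fun (fun ω hω => by
      rw [stoppedValue_soloPayoff_succ hW (hne ω hω.1), if_neg hω.2]) ?_
    rw [← sdiff_inter_self_eq_sdiff, inter_comm]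
    exact hA.diff hC

theorem integrableOn_soloPayoff (hW : IsBrownianMotion W ℱ μ) (hx : x ∈ Icc (0 : ℝ) 1)
    (σ : Player → Strategy ℱ) (k : ℕ) (P : Player) (h : IsPosition ℱ W x ρ A) :
    IntegrableOn (stoppedValue (soloPayoff W x σ k P) ρ) A μ := by
  induction k generalizing P ρ A with
  | zero => exact (integrable_outcome hW hx).integrableOn
  | succ k ih =>
    have hC := isPosition_proposalTime hW σ (k + 1) P h
    exact integrableOn_soloPayoff_succ hW hx h.measurableSet' h.ne_top hC.measurableSet'
      (integrableOn_proposalPayoff_of_soloPayoff (ih _) hC)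

theorem integrableOn_proposalPayoff (hW : IsBrownianMotion W ℱ μ) (hx : x ∈ Icc (0 : ℝ) 1)
    (σ : Player → Strategy ℱ) (k : ℕ) (P : Player) (h : IsPosition ℱ W x ρ A) :
    IntegrableOn (stoppedValue (proposalPayoff W x σ k P) ρ) A μ :=
  integrableOn_proposalPayoff_of_soloPayoff (integrableOn_soloPayoff hW hx σ k P.opp) h

/-- A stage of the game ends with a proposal or with the end of the game. -/
theorem setIntegral_soloPayoff_succ (hW : IsBrownianMotion W ℱ μ) (hx : x ∈ Icc (0 : ℝ) 1)
    (hA : MeasurableSet A) (hne : ∀ ω ∈ A, ρ ω ≠ ⊤)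
    (hC : IsPosition ℱ W x (proposalTime σ (k + 1) P ρ)
      (A ∩ counted W x (proposalTime σ (k + 1) P ρ))) (c : ℝ) :
    ∫ ω in A, c * stoppedValue (soloPayoff W x σ (k + 1) P) ρ ω ∂μ =
      ∫ ω in A ∩ counted W x (proposalTime σ (k + 1) P ρ),
        c * stoppedValue (proposalPayoff W x σ k P) (proposalTime σ (k + 1) P ρ) ω ∂μ +
      ∫ ω in A \ counted W x (proposalTime σ (k + 1) P ρ), c * outcome W x ω ∂μ := by
  classical
  have hint := integrableOn_soloPayoff_succ hW hx hA hne hC.measurableSet'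
    (integrableOn_proposalPayoff hW hx σ k P hC)
  have hsd : MeasurableSet (A \ counted W x (proposalTime σ (k + 1) P ρ)) := by
    rw [← sdiff_inter_self_eq_sdiff, inter_comm]
    exact hA.diff hC.measurableSet'
  have hsplit : ∫ ω in A, c * stoppedValue (soloPayoff W x σ (k + 1) P) ρ ω ∂μ =
      ∫ ω in A ∩ counted W x (proposalTime σ (k + 1) P ρ),
        c * stoppedValue (soloPayoff W x σ (k + 1) P) ρ ω ∂μ +
      ∫ ω in A \ counted W x (proposalTime σ (k + 1) P ρ),
        c * stoppedValue (soloPayoff W x σ (k + 1) P) ρ ω ∂μ := by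
    conv_lhs => rw [← inter_union_sdiff A (counted W x (proposalTime σ (k + 1) P ρ))]
    have hcint : IntegrableOn (fun ω => c * stoppedValue (soloPayoff W x σ (k + 1) P) ρ ω) A μ :=
      Integrable.const_mul hint c
    exact setIntegral_union disjoint_sdiff_inter.symm hsd
      (hcint.mono_set inter_subset_left) (hcint.mono_set sdiff_subset)
  rw [hsplit]
  congr 1
  · exact setIntegral_congr_fun hC.measurableSet' fun ω hω => by
      simp only [stoppedValue_soloPayoff_succ hW (hne ω hω.1), if_pos hω.2]
  · exact setIntegral_congr_fun hsd fun ω hω => by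
      simp only [stoppedValue_soloPayoff_succ hW (hne ω hω.1), if_neg hω.2]

/-- A proposal is either declined or accepted. -/
theorem setIntegral_proposalPayoff (hW : IsBrownianMotion W ℱ μ) (hx : x ∈ Icc (0 : ℝ) 1)
    (h : IsPosition ℱ W x ρ A) :
    ∫ ω in A, P.sign * stoppedValue (proposalPayoff W x σ k P) ρ ω ∂μ =
      ∫ _ in A ∩ foldSet σ (k + 1) P.opp ρ, (1 : ℝ) ∂μ +
      -2 * ∫ ω in A \ foldSet σ (k + 1) P.opp ρ,
        P.opp.sign * stoppedValue (soloPayoff W x σ k P.opp) ρ ω ∂μ := by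
  have hf := measurableSet_foldSet σ (k + 1) P.opp h.isStoppingTime
  have hfm : MeasurableSet (foldSet σ (k + 1) P.opp ρ) :=
    h.isStoppingTime.measurableSpace_le _ hf
  rw [← integral_inter_add_sdiff hfm ((integrableOn_proposalPayoff hW hx σ k P h).const_mul _),
    ← integral_const_mul]
  congr 1
  · exact setIntegral_congr_fun (h.inter hf).measurableSet' fun _ hω => by
      simp only [stoppedValue_proposalPayoff_of_mem hω.2, Player.sign_mul_sign]
  · refine setIntegral_congr_fun (h.diff hf).measurableSet' fun ω hω => ?_
    simp only [stoppedValue_proposalPayoff_of_notMem (h.ne_top ω hω.1) hω.2, Player.sign_opp]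
    ring

end Strategies

/-! ### The value functions: piecewise linear comparisons. -/

section Values

/-- The optimal doubling state when `k` doubles remain. -/
noncomputable def doublingState (k : ℕ) : ℝ := 4 / 5 + 1 / 5 * (-1 / 4) ^ k

theorem doublingState_zero : doublingState 0 = 1 := by norm_num [doublingState]

/-- This recursion, rather than the closed form, drives the proof: it is the indifference of the
responder between accepting and declining. -/
theorem doublingState_succ (k : ℕ) : doublingState (k + 1) = 1 - doublingState k / 4 := by
  simp only [doublingState, pow_succ]; ring

/-- The map d ↦ 1 - d/4 sends [3/4, 1] into itself. -/
theorem doublingState_mem (k : ℕ) : 3 / 4 ≤ doublingState k ∧ doublingState k ≤ 1 := by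
  induction k with
  | zero => rw [doublingState_zero]; norm_num
  | succ k ih => rw [doublingState_succ]; constructor <;> linarith [ih.1, ih.2]

theorem doublingState_pos (k : ℕ) : 0 < doublingState k := by linarith [(doublingState_mem k).1]

theorem doublingState_succ_lt_one (k : ℕ) : doublingState (k + 1) < 1 := by
  rw [doublingState_succ]; linarith [doublingState_pos k]

/-- The value of the game for a player in state `p` who alone has the right to double. -/
noncomputable def soloValue (k : ℕ) (p : ℝ) : ℝ := min 1 (-1 + 2 / doublingState k * p)

/-- The value of a proposal in state `p` when `k` further doubles remain. -/
noncomputable def proposalValue (k : ℕ) (p : ℝ) : ℝ := min 1 (-2 * soloValue k (1 - p))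

theorem continuous_soloValue (k : ℕ) : Continuous (soloValue k) := by
  unfold soloValue; fun_prop

theorem continuous_proposalValue (k : ℕ) : Continuous (proposalValue k) := by
  have := continuous_soloValue k
  unfold proposalValue; fun_prop

variable {k : ℕ} {p : ℝ}

theorem two_div_mul_doublingState (k : ℕ) : 2 / doublingState k * doublingState k = 2 :=
  div_mul_cancel₀ _ (doublingState_pos k).ne'

theorem two_le_two_div_doublingState (k : ℕ) : 2 ≤ 2 / doublingState k := by
  rw [le_div_iff₀ (doublingState_pos k)]; linarith [(doublingState_mem k).2]

theorem two_div_doublingState_le (k : ℕ) : 2 / doublingState k ≤ 8 / 3 := by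
  rw [div_le_iff₀ (doublingState_pos k)]; linarith [(doublingState_mem k).1]

theorem soloValue_eq_one (h : doublingState k ≤ p) : soloValue k p = 1 := by
  refine min_eq_left ?_
  nlinarith [two_div_mul_doublingState k, two_le_two_div_doublingState k]

theorem soloValue_eq (h : p ≤ doublingState k) : soloValue k p = -1 + 2 / doublingState k * p := by
  refine min_eq_right ?_
  nlinarith [two_div_mul_doublingState k, two_le_two_div_doublingState k]

theorem two_mul_sub_one_le_soloValue (hp : p ∈ Icc (0 : ℝ) 1) : 2 * p - 1 ≤ soloValue k p := by
  obtain ⟨h0, h1⟩ := hp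
  refine le_min (by linarith) ?_
  nlinarith [two_le_two_div_doublingState k]

/-- Accepting a double is worse than declining it exactly above the doubling state. -/
theorem one_le_neg_two_mul_soloValue (h : doublingState (k + 1) ≤ p) :
    1 ≤ -2 * soloValue k (1 - p) := by
  rw [doublingState_succ] at h
  rw [soloValue_eq (by linarith [doublingState_pos k])]
  nlinarith [two_div_mul_doublingState k, two_le_two_div_doublingState k]

theorem proposalValue_eq_one (h : doublingState (k + 1) ≤ p) : proposalValue k p = 1 :=
  min_eq_left (one_le_neg_two_mul_soloValue h)

theorem proposalValue_le_one : proposalValue k p ≤ 1 := min_le_left _ _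

theorem neg_two_mul_soloValue_le_of_le (h : p ≤ doublingState (k + 1)) :
    -2 * soloValue k (1 - p) ≤ 1 := by
  rw [doublingState_succ] at h
  have : -(1 / 2) ≤ soloValue k (1 - p) := by
    refine le_min (by norm_num) ?_
    nlinarith [two_div_mul_doublingState k, two_le_two_div_doublingState k]
  linarith

theorem four_le_four_div_doublingState (k : ℕ) : 4 ≤ 4 / doublingState k := by
  rw [le_div_iff₀ (doublingState_pos k)]; linarith [(doublingState_mem k).2]

/-- The value of an accepted double is flat at -2 and then follows the line of slope 4/d_k through
the point (d_{k+1}, 1). In this form it can be compared with other lines through that point. -/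
theorem neg_two_mul_soloValue_eq (k : ℕ) (p : ℝ) :
    -2 * soloValue k (1 - p) = max (-2) (1 + 4 / doublingState k * (p - doublingState (k + 1))) := by
  have h : 4 / doublingState k * doublingState k = 4 := div_mul_cancel₀ _ (doublingState_pos k).ne'
  have h' : 4 / doublingState k = 2 * (2 / doublingState k) := by ring
  have hline : 1 + 4 / doublingState k * (p - doublingState (k + 1)) =
      -2 * (-1 + 2 / doublingState k * (1 - p)) := by
    rw [doublingState_succ]
    linear_combination (1 / 4) * h + (1 - p) * h'
  rw [hline, soloValue]
  rcases le_total 1 (-1 + 2 / doublingState k * (1 - p)) with h1 | h1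
  · rw [min_eq_left h1, max_eq_left (by linarith)]; norm_num
  · rw [min_eq_right h1, max_eq_right (by linarith)]

/-- A flatter increasing line through the same point (d_{k+1}, 1) lies above the value of a
proposal, as long as it has not dropped below the flat part at -2; this is what `hp` says. -/
theorem proposalValue_le_line {b : ℝ} (hb0 : 0 ≤ b) (hb : b ≤ 4 / doublingState k)
    (hp : -3 ≤ b * (p - doublingState (k + 1))) :
    proposalValue k p ≤ 1 + b * (p - doublingState (k + 1)) := by
  rcases le_total p (doublingState (k + 1)) with h | h
  · refine (min_le_right _ _).trans ?_
    rw [neg_two_mul_soloValue_eq]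
    exact max_le (by linarith) (by nlinarith)
  · exact proposalValue_le_one.trans (by nlinarith)

theorem proposalValue_lt_line_of_lt {b : ℝ} (hb : b < 4 / doublingState k)
    (hp : -3 < b * (p - doublingState (k + 1))) (h : p < doublingState (k + 1)) :
    proposalValue k p < 1 + b * (p - doublingState (k + 1)) := by
  refine (min_le_right _ _).trans_lt ?_
  rw [neg_two_mul_soloValue_eq]
  exact max_lt (by linarith) (by nlinarith)

theorem proposalValue_lt_line_of_gt {b : ℝ} (hb : 0 < b) (h : doublingState (k + 1) < p) :
    proposalValue k p < 1 + b * (p - doublingState (k + 1)) :=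
  proposalValue_le_one.trans_lt (by nlinarith)

theorem soloLine_eq (k : ℕ) (p : ℝ) :
    -1 + 2 / doublingState k * p = 1 + 2 / doublingState k * (p - doublingState k) := by
  linear_combination two_div_mul_doublingState k

/-- The line has slope at most 8/3, less than the slope 4/d_k ≥ 4 of an accepted double, and is at
least -1 for `p ≥ 0`. It therefore touches the value of a proposal only at the doubling state. -/
theorem proposalValue_lt_soloLine (hp : 0 ≤ p) (h : p ≠ doublingState (k + 1)) :
    proposalValue k p < -1 + 2 / doublingState (k + 1) * p := by
  have h2 := two_le_two_div_doublingState (k + 1)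
  rcases h.lt_or_gt with h | h
  · rw [soloLine_eq]
    refine proposalValue_lt_line_of_lt ?_ ?_ h
    · linarith [two_div_doublingState_le (k + 1), four_le_four_div_doublingState k]
    · nlinarith [two_div_mul_doublingState (k + 1)]
  · rw [soloLine_eq]
    exact proposalValue_lt_line_of_gt (by linarith) h

theorem proposalValue_le_soloValue (hp : 0 ≤ p) : proposalValue k p ≤ soloValue (k + 1) p := by
  refine le_min proposalValue_le_one ?_
  rcases eq_or_ne p (doublingState (k + 1)) with rfl | h
  · rw [proposalValue_eq_one le_rfl, two_div_mul_doublingState]; norm_num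
  · exact (proposalValue_lt_soloLine hp h).le

/-- In these states a threshold opponent doubles at once, which costs 1. Proposing at the same
moment and winning the tie is no better. -/
theorem proposalValue_le_neg_one (h : p ≤ 1 - doublingState (k + 1)) :
    proposalValue k p ≤ -1 := by
  refine (min_le_right _ _).trans ?_
  rw [neg_two_mul_soloValue_eq]
  refine max_le (by norm_num) ?_
  nlinarith [four_le_four_div_doublingState k, (doublingState_mem (k + 1)).1]

/-- The slope of the value of the game before the first double. -/
noncomputable def openingSlope (k : ℕ) : ℝ := 2 / (2 * doublingState k - 1)

theorem openingSlope_mul (k : ℕ) : openingSlope k * (2 * doublingState k - 1) = 2 :=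
  div_mul_cancel₀ _ (by linarith [(doublingState_mem k).1])

theorem openingSlope_pos (k : ℕ) : 0 < openingSlope k :=
  div_pos two_pos (by linarith [(doublingState_mem k).1])

/-- By the recursion the opening slope is 4/(2 - d_k), so the inequality amounts to d_k ≤ 1. -/
theorem openingSlope_succ_le (k : ℕ) : openingSlope (k + 1) ≤ 4 / doublingState k := by
  rw [openingSlope, div_le_div_iff₀ (by linarith [(doublingState_mem (k + 1)).1])
    (doublingState_pos k), doublingState_succ]
  linarith [(doublingState_mem k).2]

/-- Strictness needs d_{k+1} < 1, hence the shift in the index: for the last double d_0 = 1 and the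
slopes coincide. -/
theorem openingSlope_succ_lt (k : ℕ) : openingSlope (k + 2) < 4 / doublingState (k + 1) := by
  rw [openingSlope, div_lt_div_iff₀ (by linarith [(doublingState_mem (k + 2)).1])
    (doublingState_pos (k + 1)), doublingState_succ (k + 1)]
  linarith [doublingState_succ_lt_one k]

/-- The value of the game, for a player in state `p`, when both players may double. -/
noncomputable def openingValue (k : ℕ) (p : ℝ) : ℝ :=
  max (-1) (min 1 (1 + openingSlope k * (p - doublingState k)))

theorem openingValue_one_sub (k : ℕ) (p : ℝ) : openingValue k (1 - p) = -openingValue k p := by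
  have h := openingSlope_mul k
  have : 1 + openingSlope k * (1 - p - doublingState k) =
      -(1 + openingSlope k * (p - doublingState k)) := by linear_combination -h
  rw [openingValue, openingValue, this]
  rcases le_total (1 + openingSlope k * (p - doublingState k)) 1 with h1 | h1 <;>
  rcases le_total (-1) (1 + openingSlope k * (p - doublingState k)) with h2 | h2
  · rw [min_eq_right h1, max_eq_right h2, min_eq_right (by linarith), max_eq_right (by linarith)]
  · rw [min_eq_right h1, max_eq_left h2, min_eq_left (by linarith), max_eq_right (by linarith),
      neg_neg]
  · rw [min_eq_left h1, max_eq_right (show (-1 : ℝ) ≤ 1 by norm_num), min_eq_right (by linarith),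
      max_eq_left (by linarith)]
  · linarith

theorem openingValue_eq_one (h : doublingState k ≤ p) : openingValue k p = 1 := by
  have : 1 ≤ 1 + openingSlope k * (p - doublingState k) := by nlinarith [openingSlope_pos k]
  rw [openingValue, min_eq_left this, max_eq_right (by norm_num)]

theorem openingLine_ge (h : 1 - doublingState k ≤ p) :
    -1 ≤ 1 + openingSlope k * (p - doublingState k) := by
  nlinarith [openingSlope_pos k, openingSlope_mul k]

theorem openingValue_eq (h1 : 1 - doublingState k ≤ p) (h2 : p ≤ doublingState k) :
    openingValue k p = 1 + openingSlope k * (p - doublingState k) := by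
  rw [openingValue, min_eq_right (by nlinarith [openingSlope_pos k]),
    max_eq_right (openingLine_ge h1)]

theorem openingValue_eq_neg_one (h : p ≤ 1 - doublingState k) : openingValue k p = -1 := by
  have := openingValue_eq_one (k := k) (p := 1 - p) (by linarith)
  rw [openingValue_one_sub] at this
  linarith

theorem openingValue_zero (hp : p ∈ Icc (0 : ℝ) 1) : openingValue 0 p = 2 * p - 1 := by
  rw [openingValue_eq (by rw [doublingState_zero]; linarith [hp.1])
    (by rw [doublingState_zero]; exact hp.2), openingSlope, doublingState_zero]
  ring

theorem soloValue_zero (hp : p ≤ 1) : soloValue 0 p = 2 * p - 1 := by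
  rw [soloValue_eq (by rwa [doublingState_zero]), doublingState_zero]
  ring

theorem proposalValue_le_openingLine (h : 1 - doublingState (k + 1) ≤ p) :
    proposalValue k p ≤ 1 + openingSlope (k + 1) * (p - doublingState (k + 1)) :=
  proposalValue_le_line (openingSlope_pos _).le (openingSlope_succ_le k)
    (by linarith [openingLine_ge h])

theorem proposalValue_lt_openingLine (h : 1 - doublingState (k + 1) ≤ p)
    (hne : p ≠ doublingState (k + 1)) (hk : 1 ≤ k ∨ doublingState (k + 1) < p) :
    proposalValue k p < 1 + openingSlope (k + 1) * (p - doublingState (k + 1)) := by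
  rcases hne.lt_or_gt with hlt | hgt
  · obtain ⟨j, rfl⟩ := Nat.exists_eq_add_of_le' (hk.resolve_right hlt.not_gt)
    exact proposalValue_lt_line_of_lt (openingSlope_succ_lt j) (by linarith [openingLine_ge h]) hlt
  · exact proposalValue_lt_line_of_gt (openingSlope_pos _) hgt

end Values

/-! ### The game in which one player may double: both bounds on the value. -/

section Bounds

variable {Ω : Type*} {m : MeasurableSpace Ω} {μ : Measure Ω} {ℱ : Filtration ℝ≥0 m}
  {W : ℝ≥0 → Ω → ℝ} {x : ℝ} {ρ θ : Ω → WithTop ℝ≥0} {A : Set Ω}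
  {σ : Player → Strategy ℱ} {P : Player} {k : ℕ}

theorem mem_foldSet_threshold {hW : IsBrownianMotion W ℱ μ}
    (hσ : σ P.opp = thresholdStrategy hW x doublingState P.opp) {ω : Ω} (hρ : ρ ω ≠ ⊤) :
    ω ∈ foldSet σ k P.opp ρ ↔ doublingState k ≤ viewAt W x P ρ ω := by
  obtain ⟨t, ht⟩ := WithTop.ne_top_iff_exists.mp hρ
  rw [viewAt_of_eq ht.symm]
  constructor
  · rintro ⟨s, hs, hf⟩
    rw [hσ] at hf
    obtain rfl : t = s := WithTop.coe_inj.mp (ht.trans hs)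
    simpa [thresholdStrategy] using hf
  · intro h
    refine ⟨t, ht.symm, ?_⟩
    rw [hσ]
    simpa [thresholdStrategy] using h

theorem min_exitTime_eq_of_mem {τ : Ω → WithTop ℝ≥0} {ω : Ω} (h : ω ∈ counted W x τ) :
    min (τ ω) (exitTime W x ω) = τ ω :=
  min_eq_left h.2

theorem min_exitTime_eq_of_notMem {τ : Ω → WithTop ℝ≥0} {ω : Ω} (h : ω ∉ counted W x τ) :
    min (τ ω) (exitTime W x ω) = exitTime W x ω := by
  refine min_eq_right ?_
  by_contra! hlt
  exact h ⟨hlt.ne_top, hlt.le⟩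

theorem proposalTime_threshold {hW : IsBrownianMotion W ℱ μ}
    (hσ : σ P = thresholdStrategy hW x doublingState P) {ω : Ω} {t : ℝ≥0} (h : ρ ω = t) :
    proposalTime σ k P ρ ω =
      hittingAfter (fun u ω => P.view (state W x u ω)) (Ici (doublingState k)) t ω := by
  rw [proposalTime, timeAfter_of_eq h, hσ]; rfl

/-- A player who plans to double at `c` and starts below `c` does so at `c` exactly, or else loses
the game. -/
theorem viewAt_hittingAfter_of_lt (hW : IsBrownianMotion W ℱ μ) (hx : x ∈ Icc (0 : ℝ) 1) {c : ℝ}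
    (hc : c ≤ 1) {τ : Ω → WithTop ℝ≥0} {ω : Ω} {t : ℝ≥0}
    (hω : state W x 0 ω = x ∧ exitTime W x ω ≠ ⊤) (htT : (t : WithTop ℝ≥0) ≤ exitTime W x ω)
    (hτ : τ ω = hittingAfter (fun u ω => P.view (state W x u ω)) (Ici c) t ω)
    (hlt : P.view (state W x t ω) ≤ c) :
    (ω ∈ counted W x τ → viewAt W x P (fun ω => min (τ ω) (exitTime W x ω)) ω = c) ∧
      (ω ∉ counted W x τ → viewAt W x P (fun ω => min (τ ω) (exitTime W x ω)) ω = 0) := by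
  refine ⟨fun hC => ?_, fun hC => ?_⟩
  · rw [viewAt_congr (θ := τ) (min_exitTime_eq_of_mem hC)]
    obtain ⟨s, hs⟩ := WithTop.ne_top_iff_exists.mp hC.1
    rw [viewAt_of_eq hs.symm]
    exact eq_of_hittingAfter_eq (u := fun u ω => P.view (state W x u ω))
      (continuous_view_state hW x P ω) hlt (hτ.symm.trans hs.symm)
  · rw [viewAt_congr (θ := exitTime W x) (min_exitTime_eq_of_notMem hC)]
    obtain ⟨s, hs⟩ := WithTop.ne_top_iff_exists.mp hω.2
    rw [viewAt_of_eq hs.symm]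
    have hlt' : P.view (state W x s ω) < c := by
      by_contra! hle
      refine hC ⟨?_, ?_⟩ <;> rw [hτ]
      · exact ne_top_of_le_ne_top WithTop.coe_ne_top
          (hittingAfter_le_of_mem (WithTop.coe_le_coe.mp (hs ▸ htT)) hle)
      · exact (hittingAfter_le_of_mem (WithTop.coe_le_coe.mp (hs ▸ htT)) hle).trans hs.le
    rcases state_exitTime hW (x := x) (by rw [hω.1]; exact hx) hs.symm with h | h <;>
      rw [h] at hlt' ⊢ <;> cases P <;> simp only [Player.view] at hlt' ⊢ <;> linarith

variable [IsProbabilityMeasure μ]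

/-- The threshold responder declines exactly where declining costs no more than accepting, so the
response realizes the minimum in `proposalValue`. After acceptance the roles change, so the lower
bound for the responder becomes an upper bound for the proposer. -/
theorem setIntegral_proposalPayoff_le_of (hW : IsBrownianMotion W ℱ μ) (hx : x ∈ Icc (0 : ℝ) 1)
    (hσ : σ P.opp = thresholdStrategy hW x doublingState P.opp)
    (ih : ∀ {B : Set Ω}, IsPosition ℱ W x ρ B → ∫ ω in B, soloValue k (viewAt W x P.opp ρ ω) ∂μ ≤
      ∫ ω in B, P.opp.sign * stoppedValue (soloPayoff W x σ k P.opp) ρ ω ∂μ)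
    (h : IsPosition ℱ W x ρ A) :
    ∫ ω in A, P.sign * stoppedValue (proposalPayoff W x σ k P) ρ ω ∂μ ≤
      ∫ ω in A, proposalValue k (viewAt W x P ρ ω) ∂μ := by
  have hf := measurableSet_foldSet σ (k + 1) P.opp h.isStoppingTime
  have hfm : MeasurableSet (foldSet σ (k + 1) P.opp ρ) := h.isStoppingTime.measurableSpace_le _ hf
  rw [setIntegral_proposalPayoff hW hx h,
    ← integral_inter_add_sdiff hfm (integrableOn_comp_viewAt hW hx P (continuous_proposalValue k)
      h.isStoppingTime h.measurableSet' h.le_exitTime)]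
  refine add_le_add (le_of_eq ?_) ?_
  · refine setIntegral_congr_fun (h.inter hf).measurableSet' fun ω hω => ?_
    exact (proposalValue_eq_one ((mem_foldSet_threshold hσ (h.ne_top ω hω.1)).mp hω.2)).symm
  · have h1 := ih (h.diff hf)
    have h2 : ∫ ω in A \ foldSet σ (k + 1) P.opp ρ, proposalValue k (viewAt W x P ρ ω) ∂μ =
        -2 * ∫ ω in A \ foldSet σ (k + 1) P.opp ρ, soloValue k (viewAt W x P.opp ρ ω) ∂μ := by
      rw [← integral_const_mul]
      refine setIntegral_congr_fun (h.diff hf).measurableSet' fun ω hω => ?_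
      have hlt := not_le.mp fun hle =>
        hω.2 ((mem_foldSet_threshold (k := k + 1) hσ (h.ne_top ω hω.1)).mpr hle)
      simp only [viewAt_opp]
      exact min_eq_right (neg_two_mul_soloValue_le_of_le hlt.le)
    rw [h2]
    linarith

/-- `proposalValue` is the minimum over the two responses, so this holds however the opponent
responds. -/
theorem le_setIntegral_proposalPayoff_of (hW : IsBrownianMotion W ℱ μ) (hx : x ∈ Icc (0 : ℝ) 1)
    (ih : ∀ {B : Set Ω}, IsPosition ℱ W x ρ B →
      ∫ ω in B, P.opp.sign * stoppedValue (soloPayoff W x σ k P.opp) ρ ω ∂μ ≤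
      ∫ ω in B, soloValue k (viewAt W x P.opp ρ ω) ∂μ)
    (h : IsPosition ℱ W x ρ A) :
    ∫ ω in A, proposalValue k (viewAt W x P ρ ω) ∂μ ≤
      ∫ ω in A, P.sign * stoppedValue (proposalPayoff W x σ k P) ρ ω ∂μ := by
  have hf := measurableSet_foldSet σ (k + 1) P.opp h.isStoppingTime
  have hfm : MeasurableSet (foldSet σ (k + 1) P.opp ρ) := h.isStoppingTime.measurableSpace_le _ hf
  have hint := integrableOn_comp_viewAt (μ := μ) hW hx P (continuous_proposalValue k)
      h.isStoppingTime h.measurableSet' h.le_exitTime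
  have hint' := integrableOn_comp_viewAt (μ := μ) hW hx P.opp (continuous_soloValue k)
      h.isStoppingTime h.measurableSet' h.le_exitTime
  rw [setIntegral_proposalPayoff hW hx h, ← integral_inter_add_sdiff hfm hint]
  refine add_le_add ?_ ?_
  · exact setIntegral_mono (hint.mono_set inter_subset_left)
      (integrableOn_const (measure_ne_top μ _)) fun ω => proposalValue_le_one
  · have h1 := ih (h.diff hf)
    have h2 : ∫ ω in A \ foldSet σ (k + 1) P.opp ρ, proposalValue k (viewAt W x P ρ ω) ∂μ ≤
        -2 * ∫ ω in A \ foldSet σ (k + 1) P.opp ρ, soloValue k (viewAt W x P.opp ρ ω) ∂μ := by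
      rw [← integral_const_mul]
      refine setIntegral_mono (hint.mono_set sdiff_subset)
        ((hint'.mono_set sdiff_subset).const_mul (-2)) fun ω => ?_
      simp only [viewAt_opp]
      exact min_le_right _ _
    linarith

open Classical in
/-- The value of a stage of the game that ends at the time `θ`, by a proposal if this happens in
`C`, and by the end of the game otherwise. -/
noncomputable def stageReward (W : ℝ≥0 → Ω → ℝ) (x : ℝ) (k : ℕ) (P : Player) (C : Set Ω)
    (θ : Ω → WithTop ℝ≥0) (ω : Ω) : ℝ :=
  if ω ∈ C then proposalValue k (viewAt W x P θ ω) else 2 * viewAt W x P θ ω - 1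

/-- The stage reward for the proposal time `τ`. -/
noncomputable abbrev soloReward (W : ℝ≥0 → Ω → ℝ) (x : ℝ) (k : ℕ) (P : Player)
    (τ : Ω → WithTop ℝ≥0) : Ω → ℝ :=
  stageReward W x k P (counted W x τ) fun ω => min (τ ω) (exitTime W x ω)

theorem integrableOn_soloReward (hW : IsBrownianMotion W ℱ μ) (hx : x ∈ Icc (0 : ℝ) 1)
    {τ : Ω → WithTop ℝ≥0} (hτ : IsStoppingTime ℱ τ) (hA : MeasurableSet A) :
    IntegrableOn (soloReward W x k P τ) A μ := by
  have hC : MeasurableSet (counted W x τ) :=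
    hτ.measurableSpace_le _ (measurableSet_counted hW x hτ)
  have hθ := hτ.min (isStoppingTime_exitTime hW x)
  rw [← inter_union_sdiff A (counted W x τ)]
  refine IntegrableOn.union ?_ ?_
  · exact (integrableOn_comp_viewAt hW hx P (continuous_proposalValue k) hθ (hA.inter hC)
      fun _ _ => min_le_right _ _).congr_fun (fun ω hω => (if_pos hω.2).symm) (hA.inter hC)
  · exact (integrableOn_comp_viewAt hW hx P (f := fun p => 2 * p - 1) (by fun_prop) hθ
      (hA.diff hC) fun _ _ => min_le_right _ _).congr_fun (fun ω hω => (if_neg hω.2).symm)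
        (hA.diff hC)

theorem setIntegral_soloReward (hW : IsBrownianMotion W ℱ μ) (hx : x ∈ Icc (0 : ℝ) 1)
    {τ : Ω → WithTop ℝ≥0} (hτ : IsStoppingTime ℱ τ) (hA : MeasurableSet A) :
    ∫ ω in A, soloReward W x k P τ ω ∂μ =
      ∫ ω in A ∩ counted W x τ, proposalValue k (viewAt W x P τ ω) ∂μ +
      ∫ ω in A \ counted W x τ, P.sign * outcome W x ω ∂μ := by
  have hC : MeasurableSet (counted W x τ) :=
    hτ.measurableSpace_le _ (measurableSet_counted hW x hτ)
  rw [← integral_inter_add_sdiff hC (integrableOn_soloReward hW hx hτ hA)]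
  congr 1
  · refine setIntegral_congr_fun (hA.inter hC) fun ω hω => ?_
    simp only [soloReward, stageReward, if_pos hω.2]
    rw [viewAt_congr (θ := τ) (min_exitTime_eq_of_mem hω.2)]
  · refine setIntegral_congr_ae (hA.diff hC) ?_
    filter_upwards [ae_sign_mul_outcome hW hx P] with ω h hω
    simp only [soloReward, stageReward, if_neg hω.2]
    rw [h, viewAt_congr (θ := exitTime W x) (min_exitTime_eq_of_notMem hω.2)]

/-- Whether the stage ends by a proposal or by the end of the game, its reward is at most `soloValue
(k + 1)` of the final state. This is a truncated affine function, so its expectation can only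
decrease from `ρ` on. -/
theorem setIntegral_soloReward_le (hW : IsBrownianMotion W ℱ μ) (hx : x ∈ Icc (0 : ℝ) 1)
    {τ : Ω → WithTop ℝ≥0} (hτ : IsStoppingTime ℱ τ) (h : IsPosition ℱ W x ρ A) (hρτ : ρ ≤ τ) :
    ∫ ω in A, soloReward W x k P τ ω ∂μ ≤
      ∫ ω in A, soloValue (k + 1) (viewAt W x P ρ ω) ∂μ := by
  have hθ := hτ.min (isStoppingTime_exitTime hW x)
  refine le_trans ?_ (setIntegral_min_viewAt_le hW hx h hθ
    (fun ω hω => ⟨le_min (hρτ ω) (h.le_exitTime ω hω), min_le_right _ _⟩) P (-1)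
      (2 / doublingState (k + 1)))
  refine setIntegral_mono_on_ae (integrableOn_soloReward hW hx hτ h.measurableSet')
    (integrableOn_comp_viewAt hW hx P (continuous_soloValue (k + 1)) hθ h.measurableSet'
      fun _ _ => min_le_right _ _) h.measurableSet' ?_
  filter_upwards [ae_regular hW x] with ω hω _
  have hmem := viewAt_mem_Icc hW hx P (ρ := fun ω => min (τ ω) (exitTime W x ω)) hω
    (min_le_right _ _)
  simp only [soloReward, stageReward]
  split_ifs
  · exact proposalValue_le_soloValue hmem.1
  · exact two_mul_sub_one_le_soloValue hmem

theorem le_setIntegral_soloReward (hW : IsBrownianMotion W ℱ μ) (hx : x ∈ Icc (0 : ℝ) 1)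
    (hσ : σ P = thresholdStrategy hW x doublingState P) (h : IsPosition ℱ W x ρ A) :
    ∫ ω in A, soloValue (k + 1) (viewAt W x P ρ ω) ∂μ ≤
      ∫ ω in A, soloReward W x k P (proposalTime σ (k + 1) P ρ) ω ∂μ := by
  have hρ := h.isStoppingTime
  have hτ := isStoppingTime_proposalTime σ (k + 1) P hρ
  have hθ := hτ.min (isStoppingTime_exitTime hW x)
  -- Below the threshold the stage ends at d_{k+1} or at 0, where the reward lies on the line, so
  -- optional stopping gives equality. From the threshold on, the double is proposed at once and is
  -- worth 1.
  let B : Set Ω := {ω | viewAt W x P ρ ω < doublingState (k + 1)}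
  have hB : MeasurableSet[hρ.measurableSpace] B :=
    measurableSet_lt (measurable_viewAt hW P hρ) measurable_const
  have hBm : MeasurableSet B := hρ.measurableSpace_le _ hB
  have hAm := h.measurableSet'
  have hi1 := integrableOn_comp_viewAt (μ := μ) hW hx P (continuous_soloValue (k + 1)) hρ hAm
    h.le_exitTime
  have hi2 := integrableOn_soloReward (μ := μ) (k := k) (P := P) hW hx hτ hAm
  rw [← integral_inter_add_sdiff hBm hi1, ← integral_inter_add_sdiff hBm hi2]
  refine add_le_add (le_of_eq ?_) ?_
  · calc ∫ ω in A ∩ B, soloValue (k + 1) (viewAt W x P ρ ω) ∂μ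
        = ∫ ω in A ∩ B, (-1 + 2 / doublingState (k + 1) * viewAt W x P ρ ω) ∂μ :=
          setIntegral_congr_fun (hAm.inter hBm) fun ω hω => soloValue_eq (le_of_lt hω.2)
      _ = ∫ ω in A ∩ B, (-1 + 2 / doublingState (k + 1) * viewAt W x P
            (fun ω => min (proposalTime σ (k + 1) P ρ ω) (exitTime W x ω)) ω) ∂μ :=
          (setIntegral_viewAt_affine hW hx (h.inter hB) hθ (fun ω hω =>
            ⟨le_min (le_proposalTime _ _ _ _ ω) (h.le_exitTime ω hω.1), min_le_right _ _⟩)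
            P _ _).symm
      _ = _ := by
          refine setIntegral_congr_ae (hAm.inter hBm) ?_
          filter_upwards [ae_regular hW x] with ω hω hAB
          obtain ⟨t, ht⟩ := WithTop.ne_top_iff_exists.mp (h.ne_top ω hAB.1)
          have hlt : viewAt W x P ρ ω < doublingState (k + 1) := hAB.2
          rw [viewAt_of_eq ht.symm] at hlt
          have hv := viewAt_hittingAfter_of_lt hW hx (doublingState_mem (k + 1)).2 hω
            (ht ▸ h.le_exitTime ω hAB.1) (proposalTime_threshold hσ ht.symm) hlt.le
          simp only [soloReward, stageReward]
          split_ifs with hC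
          · rw [hv.1 hC, two_div_mul_doublingState, proposalValue_eq_one le_rfl]; norm_num
          · rw [hv.2 hC]; ring
  · refine setIntegral_mono_on (hi1.mono_set sdiff_subset) (hi2.mono_set sdiff_subset)
      (hAm.diff hBm) fun ω hω => ?_
    obtain ⟨t, ht⟩ := WithTop.ne_top_iff_exists.mp (h.ne_top ω hω.1)
    have hge : doublingState (k + 1) ≤ viewAt W x P ρ ω := not_lt.mp hω.2
    have hτρ : proposalTime σ (k + 1) P ρ ω = ρ ω := by
      rw [proposalTime_threshold hσ ht.symm, ← ht]
      rw [viewAt_of_eq ht.symm] at hge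
      exact hittingAfter_eq_self (u := fun u ω => P.view (state W x u ω)) hge
    have hC : ω ∈ counted W x (proposalTime σ (k + 1) P ρ) := by
      rw [counted, mem_ofPred_eq, hτρ]
      exact ⟨h.ne_top ω hω.1, h.le_exitTime ω hω.1⟩
    simp only [soloReward, stageReward, if_pos hC]
    have hv : viewAt W x P (fun ω => min (proposalTime σ (k + 1) P ρ ω) (exitTime W x ω)) ω =
        viewAt W x P ρ ω := viewAt_congr ((min_exitTime_eq_of_mem hC).trans hτρ)
    rw [hv, soloValue_eq_one hge, proposalValue_eq_one hge]

theorem setIntegral_soloPayoff_zero (hW : IsBrownianMotion W ℱ μ) (hx : x ∈ Icc (0 : ℝ) 1)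
    (h : IsPosition ℱ W x ρ A) :
    ∫ ω in A, P.sign * stoppedValue (soloPayoff W x σ 0 P) ρ ω ∂μ =
      ∫ ω in A, soloValue 0 (viewAt W x P ρ ω) ∂μ := by
  have hT := isStoppingTime_exitTime hW x
  calc _ = ∫ ω in A, (-1 + 2 * viewAt W x P (exitTime W x) ω) ∂μ := by
        refine setIntegral_congr_ae h.measurableSet' ?_
        filter_upwards [ae_sign_mul_outcome hW hx P] with ω hω _
        exact hω.trans (by ring)
    _ = ∫ ω in A, (-1 + 2 * viewAt W x P ρ ω) ∂μ :=
        setIntegral_viewAt_affine hW hx h hT (fun ω hω => ⟨h.le_exitTime ω hω, le_rfl⟩) P _ _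
    _ = _ := by
        refine setIntegral_congr_ae h.measurableSet' ?_
        filter_upwards [ae_regular hW x] with ω hω hA
        rw [soloValue_zero (viewAt_mem_Icc hW hx P hω (h.le_exitTime ω hA)).2]
        ring

/-- The threshold strategies guarantee the value of the game to both players. -/
theorem setIntegral_soloPayoff_bounds (hW : IsBrownianMotion W ℱ μ) (hx : x ∈ Icc (0 : ℝ) 1)
    (σ : Player → Strategy ℱ) (k : ℕ) (P : Player) (h : IsPosition ℱ W x ρ A) :
    (σ P.opp = thresholdStrategy hW x doublingState P.opp →
      ∫ ω in A, P.sign * stoppedValue (soloPayoff W x σ k P) ρ ω ∂μ ≤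
        ∫ ω in A, soloValue k (viewAt W x P ρ ω) ∂μ) ∧
    (σ P = thresholdStrategy hW x doublingState P →
      ∫ ω in A, soloValue k (viewAt W x P ρ ω) ∂μ ≤
        ∫ ω in A, P.sign * stoppedValue (soloPayoff W x σ k P) ρ ω ∂μ) := by
  induction k generalizing P ρ A with
  | zero =>
    have h0 := setIntegral_soloPayoff_zero (μ := μ) (P := P) (σ := σ) hW hx h
    exact ⟨fun _ => h0.le, fun _ => h0.ge⟩
  | succ k ih =>
    have hC := isPosition_proposalTime hW σ (k + 1) P h
    have hτ := hC.isStoppingTime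
    have hsplit := setIntegral_soloPayoff_succ hW hx h.measurableSet' h.ne_top hC P.sign
    have hreward := setIntegral_soloReward (k := k) (P := P) hW hx hτ h.measurableSet'
    constructor
    -- Each bound at `k + 1` uses the other bound at `k`, because an accepted double exchanges the
    -- roles of the players.
    · intro hσ
      have h1 := setIntegral_proposalPayoff_le_of hW hx hσ
        (fun hB => (ih P.opp hB).2 hσ) hC
      have h2 := setIntegral_soloReward_le (k := k) (P := P) hW hx hτ h (le_proposalTime σ _ P ρ)
      linarith
    · intro hσ
      have h1 := le_setIntegral_proposalPayoff_of hW hx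
        (fun hB => (ih P.opp hB).1 (by rwa [P.opp_opp])) hC
      have h2 := le_setIntegral_soloReward (k := k) hW hx hσ h
      linarith

theorem setIntegral_proposalPayoff_le (hW : IsBrownianMotion W ℱ μ) (hx : x ∈ Icc (0 : ℝ) 1)
    (hσ : σ P.opp = thresholdStrategy hW x doublingState P.opp) (k : ℕ)
    (h : IsPosition ℱ W x ρ A) :
    ∫ ω in A, P.sign * stoppedValue (proposalPayoff W x σ k P) ρ ω ∂μ ≤
      ∫ ω in A, proposalValue k (viewAt W x P ρ ω) ∂μ :=
  setIntegral_proposalPayoff_le_of hW hx hσ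
    (fun hB => (setIntegral_soloPayoff_bounds hW hx σ k P.opp hB).2 hσ) h

theorem le_setIntegral_proposalPayoff (hW : IsBrownianMotion W ℱ μ) (hx : x ∈ Icc (0 : ℝ) 1)
    (hσ : σ P = thresholdStrategy hW x doublingState P) (k : ℕ) (h : IsPosition ℱ W x ρ A) :
    ∫ ω in A, proposalValue k (viewAt W x P ρ ω) ∂μ ≤
      ∫ ω in A, P.sign * stoppedValue (proposalPayoff W x σ k P) ρ ω ∂μ :=
  le_setIntegral_proposalPayoff_of hW hx
    (fun hB => (setIntegral_soloPayoff_bounds hW hx σ k P.opp hB).1 (by rwa [P.opp_opp])) h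

/-- A stage that starts at any time is worth at most its reward to a player whose opponent plays
the threshold strategy. -/
theorem setIntegral_soloPayoff_succ_le_soloReward (hW : IsBrownianMotion W ℱ μ)
    (hx : x ∈ Icc (0 : ℝ) 1) (hσ : σ P.opp = thresholdStrategy hW x doublingState P.opp)
    (hA : MeasurableSet A) (hne : ∀ ω ∈ A, ρ ω ≠ ⊤)
    (hC : IsPosition ℱ W x (proposalTime σ (k + 1) P ρ)
      (A ∩ counted W x (proposalTime σ (k + 1) P ρ))) :
    ∫ ω in A, P.sign * stoppedValue (soloPayoff W x σ (k + 1) P) ρ ω ∂μ ≤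
      ∫ ω in A, soloReward W x k P (proposalTime σ (k + 1) P ρ) ω ∂μ := by
  rw [setIntegral_soloPayoff_succ hW hx hA hne hC,
    setIntegral_soloReward hW hx hC.isStoppingTime hA]
  exact add_le_add (setIntegral_proposalPayoff_le hW hx hσ k hC) le_rfl

theorem soloReward_le_setIntegral_soloPayoff_succ (hW : IsBrownianMotion W ℱ μ)
    (hx : x ∈ Icc (0 : ℝ) 1) (hσ : σ P = thresholdStrategy hW x doublingState P)
    (hA : MeasurableSet A) (hne : ∀ ω ∈ A, ρ ω ≠ ⊤)
    (hC : IsPosition ℱ W x (proposalTime σ (k + 1) P ρ)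
      (A ∩ counted W x (proposalTime σ (k + 1) P ρ))) :
    ∫ ω in A, soloReward W x k P (proposalTime σ (k + 1) P ρ) ω ∂μ ≤
      ∫ ω in A, P.sign * stoppedValue (soloPayoff W x σ (k + 1) P) ρ ω ∂μ := by
  rw [setIntegral_soloPayoff_succ hW hx hA hne hC,
    setIntegral_soloReward hW hx hC.isStoppingTime hA]
  exact add_le_add (le_setIntegral_proposalPayoff hW hx hσ k hC) le_rfl

end Bounds

/-! ### The stage before the first double, when both players may propose. -/

section Opening

variable {Ω : Type*} {m : MeasurableSpace Ω} {μ : Measure Ω} {ℱ : Filtration ℝ≥0 m}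
  {W : ℝ≥0 → Ω → ℝ} {x : ℝ} {θ : Ω → WithTop ℝ≥0}
  {σ : Player → Strategy ℱ} {P : Player} {k : ℕ} {tie : Player}

/-- The time at which `P` first proposes, if play starts at time `0` with `k` doubles remaining. -/
noncomputable abbrev openingTime (σ : Player → Strategy ℱ) (k : ℕ) (P : Player) :
    Ω → WithTop ℝ≥0 :=
  proposalTime σ k P fun _ => ((0 : ℝ≥0) : WithTop ℝ≥0)

theorem openingTime_apply (σ : Player → Strategy ℱ) (k : ℕ) (P : Player) (ω : Ω) :
    openingTime σ k P ω = (σ P).propose k 0 ω :=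
  timeAfter_of_eq rfl

theorem isStoppingTime_openingTime (σ : Player → Strategy ℱ) (k : ℕ) (P : Player) :
    IsStoppingTime ℱ (openingTime σ k P) :=
  isStoppingTime_proposalTime σ k P (isStoppingTime_const ℱ 0)

theorem isStoppingTime_min_exitTime (hW : IsBrownianMotion W ℱ μ) (x : ℝ)
    {τ : Ω → WithTop ℝ≥0} (hτ : IsStoppingTime ℱ τ) :
    IsStoppingTime ℱ fun ω => min (τ ω) (exitTime W x ω) :=
  hτ.min (isStoppingTime_exitTime hW x)

theorem firstProposer_eq_iff (σ : Player → Strategy ℱ) (tie : Player) (k : ℕ) (P : Player)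
    (ω : Ω) : firstProposer σ tie k ω = P ↔
      if tie = P then openingTime σ k P ω ≤ openingTime σ k P.opp ω
      else openingTime σ k P ω < openingTime σ k P.opp ω := by
  simp only [openingTime_apply, firstProposer]
  rcases lt_trichotomy ((σ Player.A).propose k 0 ω) ((σ Player.B).propose k 0 ω) with h | h | h
  · cases P <;> cases tie <;> simp [Player.opp, h, h.le, h.not_gt, h.not_ge]
  · cases P <;> cases tie <;> simp [Player.opp, h]
  · cases P <;> cases tie <;> simp [Player.opp, h, h.le, h.not_gt, h.not_ge]

theorem openingTime_le_of_firstProposer_eq {ω : Ω} (h : firstProposer σ tie k ω = P) :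
    openingTime σ k P ω ≤ openingTime σ k P.opp ω := by
  have := (firstProposer_eq_iff σ tie k P ω).mp h
  split_ifs at this
  · exact this
  · exact this.le

/-- The order of two stopping times is known at either of them, so the event is known when `P`
proposes. -/
theorem measurableSet_firstProposer (σ : Player → Strategy ℱ) (tie : Player) (k : ℕ)
    (P : Player) : MeasurableSet[(isStoppingTime_openingTime σ k P).measurableSpace]
      {ω | firstProposer σ tie k ω = P} := by
  have hP := isStoppingTime_openingTime σ k P
  have hQ := isStoppingTime_openingTime σ k P.opp
  simp only [firstProposer_eq_iff]
  split_ifs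
  · exact hP.measurableSet_le_stopping_time hQ
  · convert (hQ.measurableSet_stopping_time_le hP).compl using 1
    ext ω
    simp

theorem compl_firstProposer (σ : Player → Strategy ℱ) (tie : Player) (k : ℕ) (P : Player) :
    {ω | firstProposer σ tie k ω = P}ᶜ = {ω | firstProposer σ tie k ω = P.opp} := by
  ext ω
  rcases P.eq_or_eq_opp (firstProposer σ tie k ω) with h | h
  · simp [h, P.opp_ne.symm]
  · simp [h, P.opp_ne]

theorem viewAt_of_eq_zero {ω : Ω} (hω : state W x 0 ω = x) (h : θ ω = ((0 : ℝ≥0) : WithTop ℝ≥0)) :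
    viewAt W x P θ ω = P.view x := by
  rw [viewAt_of_eq h, hω]

theorem openingTime_of_doublesAt {c : ℝ} (h : DoublesAt W x P (σ P) k c) (ω : Ω) :
    openingTime σ k P ω = hittingAfter (fun u ω => P.view (state W x u ω)) (Ici c) 0 ω :=
  (openingTime_apply σ k P ω).trans (h 0 ω)

theorem doublesAt_threshold (hW : IsBrownianMotion W ℱ μ) (x : ℝ) (d : ℕ → ℝ) (P : Player)
    (k : ℕ) : DoublesAt W x P (thresholdStrategy hW x d P) k (d k) :=
  fun _ _ => rfl

theorem openingTime_eq_zero {c : ℝ} (h : DoublesAt W x P (σ P) k c) {ω : Ω}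
    (hω : state W x 0 ω = x) (hc : c ≤ P.view x) :
    openingTime σ k P ω = ((0 : ℝ≥0) : WithTop ℝ≥0) := by
  rw [openingTime_of_doublesAt h]
  refine hittingAfter_eq_self (u := fun u ω => P.view (state W x u ω)) ?_
  simpa [hω] using hc

theorem le_viewAt_of_mem_counted (hW : IsBrownianMotion W ℱ μ) {c : ℝ}
    (h : DoublesAt W x P (σ P) k c) {ω : Ω} (hC : ω ∈ counted W x (openingTime σ k P)) :
    c ≤ viewAt W x P (openingTime σ k P) ω := by
  obtain ⟨s, hs⟩ := WithTop.ne_top_iff_exists.mp hC.1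
  rw [viewAt_of_eq hs.symm]
  exact (mem_of_hittingAfter_eq (continuous_view_state hW x P ω) isClosed_Ici
    ((openingTime_of_doublesAt h ω).symm.trans hs.symm)).2

theorem viewAt_openingTime_of_lt (hW : IsBrownianMotion W ℱ μ) (hx : x ∈ Icc (0 : ℝ) 1) {c : ℝ}
    (hc : c ≤ 1) (h : DoublesAt W x P (σ P) k c) {ω : Ω}
    (hω : state W x 0 ω = x ∧ exitTime W x ω ≠ ⊤) (hlt : P.view x ≤ c) :
    (ω ∈ counted W x (openingTime σ k P) →
      viewAt W x P (fun ω => min (openingTime σ k P ω) (exitTime W x ω)) ω = c) ∧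
    (ω ∉ counted W x (openingTime σ k P) →
      viewAt W x P (fun ω => min (openingTime σ k P ω) (exitTime W x ω)) ω = 0) :=
  viewAt_hittingAfter_of_lt hW hx hc hω (le_hittingAfter ω) (openingTime_of_doublesAt h ω)
    (by rw [hω.1]; exact hlt)

theorem viewAt_le_of_le_openingTime (hW : IsBrownianMotion W ℱ μ) {c : ℝ}
    (h : DoublesAt W x P (σ P) k c) {ω : Ω}
    (hω : state W x 0 ω = x ∧ exitTime W x ω ≠ ⊤) (hlt : P.view x ≤ c)
    (hθ : θ ω ≤ openingTime σ k P ω) (hθT : θ ω ≤ exitTime W x ω) :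
    viewAt W x P θ ω ≤ c := by
  obtain ⟨s, hs⟩ := WithTop.ne_top_iff_exists.mp (ne_top_of_le_ne_top hω.2 hθT)
  rw [viewAt_of_eq hs.symm]
  refine le_of_le_hittingAfter (u := fun u ω => P.view (state W x u ω)) (t := 0)
    (continuous_view_state hW x P ω) (by rw [hω.1]; exact hlt) zero_le ?_
  rw [hs, ← openingTime_of_doublesAt h]
  exact hθ

open Classical in
/-- The value to `P` of the stage before the first double. -/
noncomputable def openingReward (W : ℝ≥0 → Ω → ℝ) (x : ℝ) (σ : Player → Strategy ℱ)
    (tie : Player) (k : ℕ) (P : Player) (ω : Ω) : ℝ :=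
  if firstProposer σ tie (k + 1) ω = P then soloReward W x k P (openingTime σ (k + 1) P) ω
  else -soloReward W x k P.opp (openingTime σ (k + 1) P.opp) ω

/-- The time at which the stage before the first double ends. -/
noncomputable def openingEnd (W : ℝ≥0 → Ω → ℝ) (x : ℝ) (σ : Player → Strategy ℱ)
    (k : ℕ) (P : Player) (ω : Ω) : WithTop ℝ≥0 :=
  min (min (openingTime σ k P ω) (openingTime σ k P.opp ω)) (exitTime W x ω)

theorem openingReward_of_eq {ω : Ω} (h : firstProposer σ tie (k + 1) ω = P) :
    (ω ∈ counted W x (openingTime σ (k + 1) P) →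
      openingReward W x σ tie k P ω =
        proposalValue k (viewAt W x P (openingEnd W x σ (k + 1) P) ω)) ∧
    (ω ∉ counted W x (openingTime σ (k + 1) P) →
      openingReward W x σ tie k P ω = 2 * viewAt W x P (openingEnd W x σ (k + 1) P) ω - 1) := by
  have hend : viewAt W x P (openingEnd W x σ (k + 1) P) ω =
      viewAt W x P (fun ω => min (openingTime σ (k + 1) P ω) (exitTime W x ω)) ω :=
    viewAt_congr (by simp only [openingEnd, min_eq_left (openingTime_le_of_firstProposer_eq h)])
  rw [hend]
  refine ⟨fun hC => ?_, fun hC => ?_⟩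
  · simp only [openingReward, if_pos h, soloReward, stageReward, if_pos hC]
  · simp only [openingReward, if_pos h, soloReward, stageReward, if_neg hC]

theorem openingReward_of_ne {ω : Ω} (h : firstProposer σ tie (k + 1) ω ≠ P) :
    (ω ∈ counted W x (openingTime σ (k + 1) P.opp) →
      openingReward W x σ tie k P ω =
        -proposalValue k (1 - viewAt W x P (openingEnd W x σ (k + 1) P) ω)) ∧
    (ω ∉ counted W x (openingTime σ (k + 1) P.opp) →
      openingReward W x σ tie k P ω = 2 * viewAt W x P (openingEnd W x σ (k + 1) P) ω - 1) := by
  have hle := openingTime_le_of_firstProposer_eq ((P.eq_or_eq_opp _).resolve_left h)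
  rw [P.opp_opp] at hle
  have hend : 1 - viewAt W x P (openingEnd W x σ (k + 1) P) ω =
      viewAt W x P.opp (fun ω => min (openingTime σ (k + 1) P.opp ω) (exitTime W x ω)) ω := by
    rw [← viewAt_opp]
    exact viewAt_congr (by simp only [openingEnd, min_eq_right hle])
  refine ⟨fun hC => ?_, fun hC => ?_⟩
  · rw [hend]
    simp only [openingReward, if_neg h, soloReward, stageReward, if_pos hC]
  · simp only [openingReward, if_neg h, soloReward, stageReward, if_neg hC, ← hend]
    ring

section Comparison

variable {ω : Ω}

/-- The opponent doubles only when it is worth it, so the reward of a stage is at most `1`. -/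
theorem openingReward_le_one (hW : IsBrownianMotion W ℱ μ) (hx : x ∈ Icc (0 : ℝ) 1)
    (hQ : DoublesAt W x P.opp (σ P.opp) (k + 1) (doublingState (k + 1)))
    (hω : state W x 0 ω = x ∧ exitTime W x ω ≠ ⊤) : openingReward W x σ tie k P ω ≤ 1 := by
  have hY := viewAt_mem_Icc hW hx P (ρ := openingEnd W x σ (k + 1) P) hω (min_le_right _ _)
  by_cases hF : firstProposer σ tie (k + 1) ω = P
  · by_cases hC : ω ∈ counted W x (openingTime σ (k + 1) P)
    · rw [(openingReward_of_eq hF).1 hC]; exact proposalValue_le_one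
    · rw [(openingReward_of_eq hF).2 hC]; linarith [hY.2]
  · by_cases hC : ω ∈ counted W x (openingTime σ (k + 1) P.opp)
    · have hle := le_viewAt_of_mem_counted hW hQ hC
      simp only [openingReward, if_neg hF, soloReward, stageReward, if_pos hC]
      rw [viewAt_congr (θ := openingTime σ (k + 1) P.opp) (min_exitTime_eq_of_mem hC),
        proposalValue_eq_one hle]
      norm_num
    · rw [(openingReward_of_ne hF).2 hC]; linarith [hY.2]

/-- The opponent proposes at time 0. Either this proposal counts and is worth 1 to the opponent, or
`P` proposes at time 0 too, which is worth at most -1. -/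
theorem openingReward_le_neg_one
    (hQ : DoublesAt W x P.opp (σ P.opp) (k + 1) (doublingState (k + 1)))
    (hω : state W x 0 ω = x ∧ exitTime W x ω ≠ ⊤) (hxP : P.view x ≤ 1 - doublingState (k + 1)) :
    openingReward W x σ tie k P ω ≤ -1 := by
  have hQ0 := openingTime_eq_zero hQ hω.1 (by rw [P.view_opp]; linarith)
  have hend : viewAt W x P (openingEnd W x σ (k + 1) P) ω = P.view x := by
    refine viewAt_of_eq_zero hω.1 (le_antisymm ?_ ?_)
    · exact (min_le_left _ _).trans ((min_le_right _ _).trans hQ0.le)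
    · exact le_min (le_min (le_proposalTime _ _ _ _ ω) hQ0.ge) (le_hittingAfter ω)
  have hcount : ∀ R : Player, openingTime σ (k + 1) R ω = ((0 : ℝ≥0) : WithTop ℝ≥0) →
      ω ∈ counted W x (openingTime σ (k + 1) R) := fun R hR =>
    ⟨hR ▸ WithTop.coe_ne_top, hR ▸ le_hittingAfter ω⟩
  by_cases hF : firstProposer σ tie (k + 1) ω = P
  · have hP0 : openingTime σ (k + 1) P ω = ((0 : ℝ≥0) : WithTop ℝ≥0) :=
      le_antisymm ((openingTime_le_of_firstProposer_eq hF).trans hQ0.le)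
        (le_proposalTime _ _ _ _ ω)
    rw [(openingReward_of_eq hF).1 (hcount P hP0), hend]
    exact proposalValue_le_neg_one hxP
  · rw [(openingReward_of_ne hF).1 (hcount _ hQ0), hend, proposalValue_eq_one (by linarith)]

/-- An opponent who starts at or below the threshold and does not propose by the end of the game has
lost it. -/
theorem viewAt_openingEnd_eq_one (hW : IsBrownianMotion W ℱ μ) (hx : x ∈ Icc (0 : ℝ) 1)
    (hQ : DoublesAt W x P.opp (σ P.opp) (k + 1) (doublingState (k + 1)))
    (hω : state W x 0 ω = x ∧ exitTime W x ω ≠ ⊤) (hxP : 1 - doublingState (k + 1) ≤ P.view x)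
    (hP : exitTime W x ω < openingTime σ (k + 1) P ω)
    (hQT : exitTime W x ω < openingTime σ (k + 1) P.opp ω) :
    viewAt W x P (openingEnd W x σ (k + 1) P) ω = 1 := by
  have h := (viewAt_openingTime_of_lt hW hx (doublingState_mem (k + 1)).2 hQ hω
    (by rw [P.view_opp]; linarith)).2 fun hC => hC.2.not_gt hQT
  have : viewAt W x P (openingEnd W x σ (k + 1) P) ω =
      viewAt W x P (fun ω => min (openingTime σ (k + 1) P.opp ω) (exitTime W x ω)) ω :=
    viewAt_congr (by
      simp only [openingEnd, min_eq_right hQT.le, min_eq_right (le_min hP.le hQT.le)])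
  rw [this]
  rw [viewAt_opp] at h
  linarith

theorem exitTime_lt_of_notMem_counted {τ : Ω → WithTop ℝ≥0} (hT : exitTime W x ω ≠ ⊤)
    (h : ω ∉ counted W x τ) : exitTime W x ω < τ ω := by
  by_contra! hle
  exact h ⟨ne_top_of_le_ne_top hT hle, hle⟩

/-- Before the first double the reward is at most affine in the state at which the stage ends. -/
theorem openingReward_le_line (hW : IsBrownianMotion W ℱ μ) (hx : x ∈ Icc (0 : ℝ) 1)
    (hQ : DoublesAt W x P.opp (σ P.opp) (k + 1) (doublingState (k + 1)))
    (hω : state W x 0 ω = x ∧ exitTime W x ω ≠ ⊤) (hxP : 1 - doublingState (k + 1) ≤ P.view x) :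
    openingReward W x σ tie k P ω ≤ 1 + openingSlope (k + 1) *
      (viewAt W x P (openingEnd W x σ (k + 1) P) ω - doublingState (k + 1)) := by
  have hs := openingSlope_pos (k + 1)
  have hd := (doublingState_mem (k + 1)).2
  have hone : viewAt W x P (openingEnd W x σ (k + 1) P) ω = 1 →
      2 * viewAt W x P (openingEnd W x σ (k + 1) P) ω - 1 ≤ 1 + openingSlope (k + 1) *
      (viewAt W x P (openingEnd W x σ (k + 1) P) ω - doublingState (k + 1)) := by
    intro h; rw [h]; nlinarith
  by_cases hF : firstProposer σ tie (k + 1) ω = P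
  · by_cases hC : ω ∈ counted W x (openingTime σ (k + 1) P)
    · rw [(openingReward_of_eq hF).1 hC]
      -- Until the opponent proposes, the opponent's view stays at or below d_{k+1}, so the view of
      -- `P` stays at or above 1 - d_{k+1}, where the line bounds the value of a proposal.
      have hle := viewAt_le_of_le_openingTime hW hQ hω (by rw [P.view_opp]; linarith)
        (θ := openingEnd W x σ (k + 1) P) ((min_le_left _ _).trans (min_le_right _ _))
        (min_le_right _ _)
      rw [viewAt_opp] at hle
      exact proposalValue_le_openingLine (by linarith)
    · rw [(openingReward_of_eq hF).2 hC]
      have hlt := exitTime_lt_of_notMem_counted hω.2 hC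
      exact hone (viewAt_openingEnd_eq_one hW hx hQ hω hxP hlt
        (hlt.trans_le (openingTime_le_of_firstProposer_eq hF)))
  · have hle := openingTime_le_of_firstProposer_eq ((P.eq_or_eq_opp _).resolve_left hF)
    rw [P.opp_opp] at hle
    by_cases hC : ω ∈ counted W x (openingTime σ (k + 1) P.opp)
    · have hv := (viewAt_openingTime_of_lt hW hx hd hQ hω (by rw [P.view_opp]; linarith)).1 hC
      have hv' : viewAt W x P.opp (openingEnd W x σ (k + 1) P) ω = doublingState (k + 1) := by
        rw [← hv]
        exact viewAt_congr (by simp only [openingEnd, min_eq_right hle])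
      rw [viewAt_opp] at hv'
      rw [(openingReward_of_ne hF).1 hC, proposalValue_eq_one hv'.ge]
      exact openingLine_ge (by linarith)
    · rw [(openingReward_of_ne hF).2 hC]
      have hlt := exitTime_lt_of_notMem_counted hω.2 hC
      exact hone (viewAt_openingEnd_eq_one hW hx hQ hω hxP (hlt.trans_le hle) hlt)

/-- A counted proposal of `P` happens at `c`, or at once at the initial state, and is strictly below
the line in both cases. Without a counted proposal by either player, both would have to lose. What
remains is a proposal of the opponent at the opponent's threshold. -/
theorem viewAt_openingEnd_of_openingReward_eq (hW : IsBrownianMotion W ℱ μ)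
    (hx : x ∈ Icc (0 : ℝ) 1)
    (hQ : DoublesAt W x P.opp (σ P.opp) (k + 1) (doublingState (k + 1)))
    (hω : state W x 0 ω = x ∧ exitTime W x ω ≠ ⊤) (hxP : 1 - doublingState (k + 1) < P.view x)
    (hxP' : P.view x < doublingState (k + 1)) {c : ℝ} (hc : c ≤ 1)
    (hP : DoublesAt W x P (σ P) (k + 1) c) (hne : c ≠ doublingState (k + 1))
    (hk : 1 ≤ k ∨ doublingState (k + 1) < c)
    (heq : openingReward W x σ tie k P ω = 1 + openingSlope (k + 1) *
      (viewAt W x P (openingEnd W x σ (k + 1) P) ω - doublingState (k + 1))) :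
    viewAt W x P (openingEnd W x σ (k + 1) P) ω = 1 - doublingState (k + 1) := by
  have hd := (doublingState_mem (k + 1)).2
  have hQ' : P.opp.view x < doublingState (k + 1) := by rw [P.view_opp]; linarith
  -- the case in which neither player doubles
  have hnone : exitTime W x ω < openingTime σ (k + 1) P ω →
      exitTime W x ω < openingTime σ (k + 1) P.opp ω → P.view x ≤ c → False := by
    intro h1 h2 hxc
    have h3 := viewAt_openingEnd_eq_one hW hx hQ hω hxP.le h1 h2
    have h4 := (viewAt_openingTime_of_lt hW hx hc hP hω hxc).2 fun hC => hC.2.not_gt h1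
    have h5 : viewAt W x P (openingEnd W x σ (k + 1) P) ω =
        viewAt W x P (fun ω => min (openingTime σ (k + 1) P ω) (exitTime W x ω)) ω :=
      viewAt_congr (by
        simp only [openingEnd, min_eq_right h1.le, min_eq_right (le_min h1.le h2.le)])
    rw [h5, h4] at h3
    exact zero_ne_one h3
  by_cases hF : firstProposer σ tie (k + 1) ω = P
  · exfalso
    have hle := openingTime_le_of_firstProposer_eq hF
    have hend : viewAt W x P (openingEnd W x σ (k + 1) P) ω =
        viewAt W x P (fun ω => min (openingTime σ (k + 1) P ω) (exitTime W x ω)) ω :=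
      viewAt_congr (by simp only [openingEnd, min_eq_left hle])
    rcases le_or_gt c (P.view x) with hcx | hcx
    · have hP0 := openingTime_eq_zero hP hω.1 hcx
      have hC : ω ∈ counted W x (openingTime σ (k + 1) P) :=
        ⟨hP0 ▸ WithTop.coe_ne_top, hP0 ▸ le_hittingAfter ω⟩
      have hv : viewAt W x P (openingEnd W x σ (k + 1) P) ω = P.view x := by
        rw [hend]
        exact viewAt_of_eq_zero hω.1 ((min_exitTime_eq_of_mem hC).trans hP0)
      rw [(openingReward_of_eq hF).1 hC, hv] at heq
      exact (proposalValue_lt_openingLine hxP.le hxP'.ne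
        (hk.imp_right fun h => absurd (h.trans_le hcx) hxP'.not_gt)).ne heq
    · by_cases hC : ω ∈ counted W x (openingTime σ (k + 1) P)
      · have hv := (viewAt_openingTime_of_lt hW hx hc hP hω hcx.le).1 hC
        rw [← hend] at hv
        rw [(openingReward_of_eq hF).1 hC, hv] at heq
        exact (proposalValue_lt_openingLine (hxP.trans hcx).le hne hk).ne heq
      · have hlt := exitTime_lt_of_notMem_counted hω.2 hC
        exact hnone hlt (hlt.trans_le hle) hcx.le
  · have hle := openingTime_le_of_firstProposer_eq ((P.eq_or_eq_opp _).resolve_left hF)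
    rw [P.opp_opp] at hle
    by_cases hC : ω ∈ counted W x (openingTime σ (k + 1) P.opp)
    · have hv := (viewAt_openingTime_of_lt hW hx hd hQ hω hQ'.le).1 hC
      have hv' : viewAt W x P.opp (openingEnd W x σ (k + 1) P) ω = doublingState (k + 1) := by
        rw [← hv]
        exact viewAt_congr (by simp only [openingEnd, min_eq_right hle])
      rw [viewAt_opp] at hv'
      linarith
    · exfalso
      have hlt := exitTime_lt_of_notMem_counted hω.2 hC
      rcases le_or_gt c (P.view x) with hcx | hcx
      · have hP0 := openingTime_eq_zero hP hω.1 hcx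
        have := hlt.trans_le (hle.trans hP0.le)
        exact this.not_ge (le_hittingAfter ω)
      · exact hnone (hlt.trans_le hle) hlt hcx.le

end Comparison

variable [IsProbabilityMeasure μ]

theorem integrable_openingReward (hW : IsBrownianMotion W ℱ μ) (hx : x ∈ Icc (0 : ℝ) 1)
    (σ : Player → Strategy ℱ) (tie : Player) (k : ℕ) (P : Player) :
    Integrable (openingReward W x σ tie k P) μ := by
  have hF := (isStoppingTime_openingTime σ (k + 1) P).measurableSpace_le _
    (measurableSet_firstProposer σ tie (k + 1) P)
  classical
  have hrew : openingReward W x σ tie k P = {ω | firstProposer σ tie (k + 1) ω = P}.piecewise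
      (soloReward W x k P (openingTime σ (k + 1) P))
      (fun ω => -soloReward W x k P.opp (openingTime σ (k + 1) P.opp) ω) := by
    funext ω
    simp only [openingReward, Set.piecewise, mem_ofPred_eq]
  rw [hrew]
  exact Integrable.piecewise hF
    (integrableOn_soloReward hW hx (isStoppingTime_openingTime σ (k + 1) P) hF)
    (integrableOn_soloReward hW hx (isStoppingTime_openingTime σ (k + 1) P.opp) hF.compl).neg

/-- Split according to who proposes first. The stage of `P` is bounded above because the opponent
responds by the threshold; the stage of the opponent is bounded below because of the value the
threshold strategy guarantees there. -/
theorem sign_mul_expectedPayoff_both_le (hW : IsBrownianMotion W ℱ μ) (hx : x ∈ Icc (0 : ℝ) 1)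
    (hσ : σ P.opp = thresholdStrategy hW x doublingState P.opp) (tie : Player) (k : ℕ) :
    P.sign * expectedPayoff μ W tie (k + 1) Right.both x σ ≤
      ∫ ω, openingReward W x σ tie k P ω ∂μ := by
  classical
  have hPt := isStoppingTime_openingTime σ (k + 1) P
  have hQt := isStoppingTime_openingTime σ (k + 1) P.opp
  have hFP := measurableSet_firstProposer σ tie (k + 1) P
  have hFQ := measurableSet_firstProposer σ tie (k + 1) P.opp
  rw [← compl_firstProposer] at hFQ
  have hF := hPt.measurableSpace_le _ hFP
  have hCP := isPosition_inter_counted (x := x) hW hPt hFP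
  have hCQ := isPosition_inter_counted (x := x) hW hQt hFQ
  set F := {ω | firstProposer σ tie (k + 1) ω = P} with hFdef
  have hne : ∀ B : Set Ω, ∀ ω ∈ B, (fun _ : Ω => ((0 : ℝ≥0) : WithTop ℝ≥0)) ω ≠ ⊤ :=
    fun _ _ _ => WithTop.coe_ne_top
  have hi1 := integrableOn_soloPayoff_succ hW hx hF (hne F) hCP.measurableSet'
    (integrableOn_proposalPayoff hW hx σ k P hCP)
  have hi2 := integrableOn_soloPayoff_succ hW hx hF.compl (hne Fᶜ) hCQ.measurableSet'
    (integrableOn_proposalPayoff hW hx σ k P.opp hCQ)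
  have hpay : (fun ω => P.sign * payoff W tie (k + 1) Right.both x σ ω) = F.piecewise
      (fun ω => P.sign * stoppedValue (soloPayoff W x σ (k + 1) P)
        (fun _ => ((0 : ℝ≥0) : WithTop ℝ≥0)) ω)
      (fun ω => -(P.opp.sign * stoppedValue (soloPayoff W x σ (k + 1) P.opp)
        (fun _ => ((0 : ℝ≥0) : WithTop ℝ≥0)) ω)) := by
    funext ω
    by_cases h : ω ∈ F
    · have h' : firstProposer σ tie (k + 1) ω = P := h
      rw [piecewise_eq_of_mem _ _ _ h, payoff, h']; rfl
    · have h' := (P.eq_or_eq_opp (firstProposer σ tie (k + 1) ω)).resolve_left h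
      rw [piecewise_eq_of_notMem _ _ _ h, payoff, h', P.sign_opp, neg_mul, neg_neg]; rfl
  have hrew : openingReward W x σ tie k P = F.piecewise
      (soloReward W x k P (openingTime σ (k + 1) P))
      (fun ω => -soloReward W x k P.opp (openingTime σ (k + 1) P.opp) ω) := by
    funext ω
    simp only [openingReward, Set.piecewise, hFdef, mem_ofPred_eq]
  have e1 := integral_piecewise hF (hi1.const_mul P.sign) (hi2.const_mul P.opp.sign).neg
  have e2 := integral_piecewise hF (integrableOn_soloReward (k := k) (P := P) hW hx hPt hF)
    (integrableOn_soloReward (k := k) (P := P.opp) hW hx hQt hF.compl).neg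
  rw [integral_neg'] at e1 e2
  rw [expectedPayoff, ← integral_const_mul, hpay, hrew]
  refine (e1.trans_le ?_).trans e2.ge
  refine add_le_add ?_ (neg_le_neg ?_)
  · exact setIntegral_soloPayoff_succ_le_soloReward hW hx hσ hF (hne F) hCP
  · exact soloReward_le_setIntegral_soloPayoff_succ hW hx hσ hF.compl (hne Fᶜ) hCQ

end Opening

/-! ### Optimality of threshold play and uniqueness of the doubling state. -/

section Game

variable {Ω : Type*} {m : MeasurableSpace Ω} {μ : Measure Ω} {ℱ : Filtration ℝ≥0 m}
  {W : ℝ≥0 → Ω → ℝ} {x : ℝ} {θ : Ω → WithTop ℝ≥0}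
  {σ : Player → Strategy ℱ} {P : Player} {k : ℕ} {tie : Player}

theorem sign_mul_expectedPayoff_only (W : ℝ≥0 → Ω → ℝ) (tie : Player) (k : ℕ) (Q : Player)
    (x : ℝ) (σ : Player → Strategy ℱ) :
    Q.sign * expectedPayoff μ W tie k (Right.only Q) x σ =
      ∫ ω in univ, Q.sign * stoppedValue (soloPayoff W x σ k Q)
        (fun _ => ((0 : ℝ≥0) : WithTop ℝ≥0)) ω ∂μ := by
  rw [setIntegral_univ, integral_const_mul]; rfl

variable [IsProbabilityMeasure μ]

theorem integral_comp_viewAt_start (hW : IsBrownianMotion W ℱ μ) (f : ℝ → ℝ) (P : Player) :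
    ∫ ω, f (viewAt W x P (fun _ => ((0 : ℝ≥0) : WithTop ℝ≥0)) ω) ∂μ = f (P.view x) := by
  rw [integral_congr_ae (g := fun _ => f (P.view x)), integral_const, probReal_univ, one_smul]
  filter_upwards [ae_regular hW x] with ω hω
  rw [viewAt_of_eq_zero hω.1 rfl]

theorem integral_viewAt_affine (hW : IsBrownianMotion W ℱ μ) (hx : x ∈ Icc (0 : ℝ) 1)
    (hθ : IsStoppingTime ℱ θ) (hT : ∀ ω, θ ω ≤ exitTime W x ω) (P : Player) (a b : ℝ) :
    ∫ ω, (a + b * viewAt W x P θ ω) ∂μ = a + b * P.view x := by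
  have h := setIntegral_viewAt_affine hW hx isPosition_zero hθ
    (fun ω _ => ⟨bot_le, hT ω⟩) P a b
  rw [setIntegral_univ, setIntegral_univ] at h
  rw [h, integral_comp_viewAt_start hW (fun p => a + b * p)]

/-- A reward that is at most affine in the final state, with equality only in one state, has a
smaller expectation than the affine function. -/
theorem integral_lt_affine (hW : IsBrownianMotion W ℱ μ) (hx : x ∈ Icc (0 : ℝ) 1)
    (hθ : IsStoppingTime ℱ θ) (hT : ∀ ω, θ ω ≤ exitTime W x ω) {R : Ω → ℝ} (hR : Integrable R μ)
    {a b y : ℝ} (hle : ∀ᵐ ω ∂μ, R ω ≤ a + b * viewAt W x P θ ω)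
    (heq : ∀ᵐ ω ∂μ, R ω = a + b * viewAt W x P θ ω → viewAt W x P θ ω = y)
    (hy : y ≠ P.view x) : ∫ ω, R ω ∂μ < a + b * P.view x := by
  have hint : Integrable (fun ω => a + b * viewAt W x P θ ω) μ := by
    rw [← integrableOn_univ]
    exact integrableOn_comp_viewAt hW hx P (f := fun p => a + b * p) (by fun_prop) hθ
      MeasurableSet.univ fun ω _ => hT ω
  rw [← integral_viewAt_affine hW hx hθ hT P a b]
  refine lt_of_le_of_ne (integral_mono_ae hR hint hle) fun h => hy ?_
  -- Equal integrals force equality almost everywhere. The stopped state is then the constant `y`,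
  -- whereas its mean is the initial state.
  have hae := (integral_eq_iff_of_ae_le hR hint hle).mp h
  have hvy : ∀ᵐ ω ∂μ, 0 + 1 * viewAt W x P θ ω = y := by
    filter_upwards [hae, heq] with ω h1 h2
    rw [h2 h1]; ring
  have hexp := integral_viewAt_affine hW hx hθ hT P 0 1
  rw [integral_congr_ae hvy, integral_const, probReal_univ, one_smul] at hexp
  linarith

/-- The value of the game for the player `P`. -/
noncomputable def gameValue (k : ℕ) (x : ℝ) (P : Player) : Right → ℝ
  | Right.both => openingValue k (P.view x)
  | Right.only Q => P.sign * Q.sign * soloValue k (Q.view x)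

theorem gameValue_opp (k : ℕ) (x : ℝ) (P : Player) (r : Right) :
    gameValue k x P.opp r = -gameValue k x P r := by
  cases r with
  | both => simp only [gameValue]; rw [P.view_opp, openingValue_one_sub]
  | only Q => simp only [gameValue]; rw [P.sign_opp]; ring

/-- Three regimes: the opponent doubles at once (-1), `P` is already at or above the threshold (at
most 1), and between them optional stopping applies to the affine bound on the reward. -/
theorem sign_mul_expectedPayoff_both_le_openingValue (hW : IsBrownianMotion W ℱ μ)
    (hx : x ∈ Icc (0 : ℝ) 1) (hσ : σ P.opp = thresholdStrategy hW x doublingState P.opp)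
    (tie : Player) (k : ℕ) :
    P.sign * expectedPayoff μ W tie k Right.both x σ ≤ openingValue k (P.view x) := by
  cases k with
  | zero =>
    have h : expectedPayoff μ W tie 0 Right.both x σ =
        expectedPayoff μ W tie 0 (Right.only P) x σ := by
      simp only [expectedPayoff, payoff, soloPayoff]
    have hv := P.view_mem_Icc hx
    rw [h, sign_mul_expectedPayoff_only, setIntegral_soloPayoff_zero hW hx isPosition_zero,
      setIntegral_univ, integral_comp_viewAt_start hW (soloValue 0), soloValue_zero hv.2,
      openingValue_zero hv]
  | succ k =>
    refine (sign_mul_expectedPayoff_both_le hW hx hσ tie k).trans ?_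
    have hint := integrable_openingReward (μ := μ) hW hx σ tie k P
    have hQ : DoublesAt W x P.opp (σ P.opp) (k + 1) (doublingState (k + 1)) :=
      hσ ▸ doublesAt_threshold hW x doublingState P.opp (k + 1)
    have hconst : ∀ c : ℝ, (∀ᵐ ω ∂μ, openingReward W x σ tie k P ω ≤ c) →
        ∫ ω, openingReward W x σ tie k P ω ∂μ ≤ c := fun c hc => by
      simpa using integral_mono_ae hint (integrable_const c) hc
    rcases le_total (P.view x) (1 - doublingState (k + 1)) with h1 | h1
    · rw [openingValue_eq_neg_one h1]
      refine hconst _ ?_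
      filter_upwards [ae_regular hW x] with ω hω
      exact openingReward_le_neg_one hQ hω h1
    rcases le_total (doublingState (k + 1)) (P.view x) with h2 | h2
    · rw [openingValue_eq_one h2]
      refine hconst _ ?_
      filter_upwards [ae_regular hW x] with ω hω
      exact openingReward_le_one hW hx hQ hω
    · rw [openingValue_eq h1 h2]
      have hθ := isStoppingTime_min_exitTime hW x
        ((isStoppingTime_openingTime σ (k + 1) P).min (isStoppingTime_openingTime σ (k + 1) P.opp))
      have haff := integral_viewAt_affine (θ := openingEnd W x σ (k + 1) P) hW hx hθ
        (fun ω => min_le_right _ _) P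
        (1 - openingSlope (k + 1) * doublingState (k + 1)) (openingSlope (k + 1))
      have hcalc : 1 + openingSlope (k + 1) * (P.view x - doublingState (k + 1)) =
        (1 - openingSlope (k + 1) * doublingState (k + 1)) +
          openingSlope (k + 1) * P.view x := by ring
      rw [hcalc, ← haff]
      refine integral_mono_ae hint ?_ ?_
      · rw [← integrableOn_univ]
        exact integrableOn_comp_viewAt hW hx P (f := fun p => (1 - openingSlope (k + 1) *
          doublingState (k + 1)) + openingSlope (k + 1) * p) (by fun_prop) hθ MeasurableSet.univ
          fun ω _ => min_le_right _ _
      · filter_upwards [ae_regular hW x] with ω hω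
        exact (openingReward_le_line hW hx hQ hω h1).trans_eq (by ring)

/-- Against the threshold strategy no player gets more than the value of the game. -/
theorem sign_mul_expectedPayoff_le (hW : IsBrownianMotion W ℱ μ) (hx : x ∈ Icc (0 : ℝ) 1)
    (hσ : σ P.opp = thresholdStrategy hW x doublingState P.opp) (tie : Player) (k : ℕ)
    (r : Right) : P.sign * expectedPayoff μ W tie k r x σ ≤ gameValue k x P r := by
  cases r with
  | both => exact sign_mul_expectedPayoff_both_le_openingValue hW hx hσ tie k
  | only Q =>
    have hpos := isPosition_zero (ℱ := ℱ) (W := W) (x := x)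
    have hb := setIntegral_soloPayoff_bounds (μ := μ) hW hx σ k Q hpos
    rw [← sign_mul_expectedPayoff_only W tie, setIntegral_univ,
      integral_comp_viewAt_start hW (soloValue k)] at hb
    simp only [gameValue]
    rcases P.eq_or_eq_opp Q with rfl | rfl
    · rw [Player.sign_mul_sign, one_mul]
      exact hb.1 hσ
    · have := hb.2 hσ
      rw [P.sign_opp] at this ⊢
      rw [mul_neg, P.sign_mul_sign]
      linarith

/-- With the threshold strategy each player gets at least the value of the game. -/
theorem gameValue_le (hW : IsBrownianMotion W ℱ μ) (hx : x ∈ Icc (0 : ℝ) 1)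
    (hσ : σ P = thresholdStrategy hW x doublingState P) (tie : Player) (k : ℕ)
    (r : Right) : gameValue k x P r ≤ P.sign * expectedPayoff μ W tie k r x σ := by
  -- What the opponent cannot exceed is, with the opposite sign, what `P` is guaranteed.
  have h := sign_mul_expectedPayoff_le (P := P.opp) (σ := σ) hW hx (by rwa [P.opp_opp]) tie k r
  rw [gameValue_opp, P.sign_opp] at h
  linarith

theorem isOptimalPlay_threshold (hW : IsBrownianMotion W ℱ μ) (hx : x ∈ Icc (0 : ℝ) 1)
    (tie : Player) (k : ℕ) (r : Right) :
    IsOptimalPlay μ W tie k r x (thresholdStrategy hW x doublingState) := fun P _ =>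
  (sign_mul_expectedPayoff_le hW hx (Function.update_of_ne P.opp_ne _ _) tie k r).trans
    (gameValue_le hW hx rfl tie k r)

theorem isOptimalDoublingState_doublingState (hW : IsBrownianMotion W ℱ μ)
    (hx : x ∈ Icc (0 : ℝ) 1) (tie : Player) (k : ℕ) (r : Right) (P : Player) :
    IsOptimalDoublingState ℱ μ W tie k r x P (doublingState k) :=
  ⟨⟨(doublingState_pos k).le, (doublingState_mem k).2⟩, thresholdStrategy hW x doublingState,
    isOptimalPlay_threshold hW hx tie k r, doublesAt_threshold hW x doublingState P k⟩

/-- If doubling at `c` is optimal, it attains the value of the game against the threshold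
strategy. -/
theorem IsOptimalDoublingState.exists_strategy (hW : IsBrownianMotion W ℱ μ)
    (hx : x ∈ Icc (0 : ℝ) 1) {r : Right} {c : ℝ}
    (h : IsOptimalDoublingState ℱ μ W tie k r x P c) :
    ∃ σ : Player → Strategy ℱ, σ P.opp = thresholdStrategy hW x doublingState P.opp ∧
      DoublesAt W x P (σ P) k c ∧ gameValue k x P r ≤ P.sign * expectedPayoff μ W tie k r x σ := by
  obtain ⟨-, σ, hopt, hc⟩ := h
  refine ⟨Function.update σ P.opp (thresholdStrategy hW x doublingState P.opp),
    Function.update_self _ _ _, ?_, ?_⟩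
  · rwa [Function.update_of_ne P.opp_ne.symm]
  · have h1 := hopt P (thresholdStrategy hW x doublingState P)
    have h2 := hopt P.opp (thresholdStrategy hW x doublingState P.opp)
    have h3 := gameValue_le (σ := Function.update σ P (thresholdStrategy hW x doublingState P))
      hW hx (Function.update_self P _ σ) tie k r
    rw [P.sign_opp] at h2
    linarith

/-- With `c` off the doubling state, the reward meets the line only when the game is lost at 0. The
initial state is positive, so the value is not attained. -/
theorem not_isOptimalDoublingState_only (hW : IsBrownianMotion W ℱ μ)
    (h0 : 0 < P.view x) (h1 : P.view x < doublingState (k + 1)) (hx : x ∈ Icc (0 : ℝ) 1) {c : ℝ}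
    (hne : c ≠ doublingState (k + 1)) :
    ¬ IsOptimalDoublingState ℱ μ W tie (k + 1) (Right.only P) x P c := by
  intro h
  have hc := h.1
  obtain ⟨σ, hσ, hP, hval⟩ := h.exists_strategy hW hx
  have hpos := isPosition_zero (ℱ := ℱ) (W := W) (x := x)
  have hτ := isStoppingTime_openingTime σ (k + 1) P
  have hle := setIntegral_soloPayoff_succ_le_soloReward hW hx hσ MeasurableSet.univ hpos.ne_top
    (isPosition_proposalTime hW σ (k + 1) P hpos)
  rw [← sign_mul_expectedPayoff_only W tie, setIntegral_univ] at hle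
  have hR := integrableOn_soloReward (k := k) (P := P) hW hx hτ MeasurableSet.univ
  rw [integrableOn_univ] at hR
  simp only [gameValue, Player.sign_mul_sign, one_mul, soloValue_eq h1.le] at hval
  refine (hval.trans hle).not_gt (integral_lt_affine hW hx (isStoppingTime_min_exitTime hW x hτ)
    (fun ω => min_le_right _ _) hR (y := 0) ?_ ?_ h0.ne)
  · filter_upwards [ae_regular hW x] with ω hω
    have hmem := viewAt_mem_Icc hW hx P (ρ := fun ω => min (openingTime σ (k + 1) P ω)
      (exitTime W x ω)) hω (min_le_right _ _)
    simp only [soloReward, stageReward]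
    split_ifs
    · exact (proposalValue_le_soloValue hmem.1).trans (min_le_right _ _)
    · exact (two_mul_sub_one_le_soloValue (k := k + 1) hmem).trans (min_le_right _ _)
  · filter_upwards [ae_regular hW x] with ω hω heq
    by_contra hY
    rcases le_or_gt c (P.view x) with hcx | hcx
    · have hτ0 := openingTime_eq_zero hP hω.1 hcx
      have hC : ω ∈ counted W x (openingTime σ (k + 1) P) :=
        ⟨hτ0 ▸ WithTop.coe_ne_top, hτ0 ▸ le_hittingAfter ω⟩
      simp only [soloReward, stageReward, if_pos hC] at heq
      rw [viewAt_of_eq_zero hω.1 ((min_exitTime_eq_of_mem hC).trans hτ0)] at heq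
      exact (proposalValue_lt_soloLine h0.le h1.ne).ne heq
    · have hv := viewAt_openingTime_of_lt hW hx hc.2 hP hω hcx.le
      by_cases hC : ω ∈ counted W x (openingTime σ (k + 1) P)
      · simp only [soloReward, stageReward, if_pos hC, hv.1 hC] at heq
        exact (proposalValue_lt_soloLine hc.1 hne).ne heq
      · exact hY (hv.2 hC)

/-- Here the reward meets the line only where the opponent doubles, at 1 - d_{k+1}. The alternative
in `hk` reflects that for the last double the value of a proposal follows the line below the
doubling state. -/
theorem not_isOptimalDoublingState_both (hW : IsBrownianMotion W ℱ μ)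
    (h0 : 1 - doublingState (k + 1) < P.view x) (h1 : P.view x < doublingState (k + 1))
    (hx : x ∈ Icc (0 : ℝ) 1) {c : ℝ} (hne : c ≠ doublingState (k + 1))
    (hk : 1 ≤ k ∨ doublingState (k + 1) < c) :
    ¬ IsOptimalDoublingState ℱ μ W tie (k + 1) Right.both x P c := by
  intro h
  have hc := h.1
  obtain ⟨σ, hσ, hP, hval⟩ := h.exists_strategy hW hx
  have hQ : DoublesAt W x P.opp (σ P.opp) (k + 1) (doublingState (k + 1)) :=
    hσ ▸ doublesAt_threshold hW x doublingState P.opp (k + 1)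
  have hθ := isStoppingTime_min_exitTime hW x
    ((isStoppingTime_openingTime σ (k + 1) P).min (isStoppingTime_openingTime σ (k + 1) P.opp))
  have hle := sign_mul_expectedPayoff_both_le hW hx hσ tie k
  simp only [gameValue, openingValue_eq h0.le h1.le] at hval
  have hline : ∀ p, 1 + openingSlope (k + 1) * (p - doublingState (k + 1)) =
      (1 - openingSlope (k + 1) * doublingState (k + 1)) + openingSlope (k + 1) * p :=
    fun p => by ring
  rw [hline] at hval
  refine (hval.trans hle).not_gt (integral_lt_affine (θ := openingEnd W x σ (k + 1) P) hW hx hθ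
    (fun ω => min_le_right _ _) (integrable_openingReward hW hx σ tie k P)
    (y := 1 - doublingState (k + 1)) ?_ ?_ h0.ne)
  · filter_upwards [ae_regular hW x] with ω hω
    rw [← hline]
    exact openingReward_le_line hW hx hQ hω h0.le
  · filter_upwards [ae_regular hW x] with ω hω heq
    rw [← hline] at heq
    exact viewAt_openingEnd_of_openingReward_eq hW hx hQ hω h0 h1 hc.2 hP hne hk heq

end Game

end DoublingGame

theorem theorem1p2 {Ω : Type*} {m : MeasurableSpace Ω} (μ : Measure Ω) [IsProbabilityMeasure μ]
    (ℱ : Filtration ℝ≥0 m) (W : ℝ≥0 → Ω → ℝ) (hW : IsBrownianMotion W ℱ μ) (tie : Player)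
    (d : ℕ → ℝ) (hd : ∀ k, d k = 4 / 5 + 1 / 5 * (-1 / 4) ^ k) :
    -- Doubling at the states `d j` is optimal play, from every position.
    (∀ x ∈ Icc (0 : ℝ) 1, ∃ σ : Player → Strategy ℱ,
      (∀ (P : Player) (j : ℕ), 1 ≤ j → DoublesAt W x P (σ P) j (d j)) ∧
      ∀ (k : ℕ) (r : Right), IsOptimalPlay μ W tie k r x σ) ∧
    -- A player who alone has the right to double has no other optimal doubling state.
    (∀ (k : ℕ), 1 ≤ k → ∀ (P : Player) (x : ℝ), 0 < P.view x → P.view x < d k →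
      ∀ c : ℝ, IsOptimalDoublingState ℱ μ W tie k (Right.only P) x P c ↔ c = d k) ∧
    -- Before the first double, `d k` is the largest optimal doubling state ...
    (∀ (k : ℕ), 1 ≤ k → ∀ (P : Player) (x : ℝ), 1 - d k < x → x < d k →
      IsGreatest {c : ℝ | IsOptimalDoublingState ℱ μ W tie k Right.both x P c} (d k)) ∧
    -- ... and the only one if at least two doubles remain.
    (∀ (k : ℕ), 2 ≤ k → ∀ (P : Player) (x : ℝ), 1 - d k < x → x < d k →
      ∀ c : ℝ, IsOptimalDoublingState ℱ μ W tie k Right.both x P c ↔ c = d k) := by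
  obtain rfl : d = doublingState := funext hd
  have hview : ∀ {k : ℕ} (P : Player) {x : ℝ}, 1 - doublingState k < x → x < doublingState k →
      1 - doublingState k < P.view x ∧ P.view x < doublingState k ∧ x ∈ Icc (0 : ℝ) 1 := by
    intro k P x h1 h2
    have hle := (doublingState_mem k).2
    refine ⟨?_, ?_, by linarith, by linarith⟩ <;> cases P <;> simp only [Player.view] <;> linarith
  refine ⟨fun x hx => ⟨thresholdStrategy hW x doublingState,
    fun P j _ => doublesAt_threshold hW x doublingState P j,
    fun k r => isOptimalPlay_threshold hW hx tie k r⟩, ?_, ?_, ?_⟩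
  · intro k hk P x h0 h1 c
    obtain ⟨j, rfl⟩ := Nat.exists_eq_add_of_le' hk
    have hx : x ∈ Icc (0 : ℝ) 1 := by
      have hle := (doublingState_mem (j + 1)).2
      constructor <;> cases P <;> simp only [Player.view] at h0 h1 <;> linarith
    refine ⟨fun h => ?_, ?_⟩
    · by_contra hne
      exact not_isOptimalDoublingState_only hW h0 h1 hx hne h
    · rintro rfl
      exact isOptimalDoublingState_doublingState hW hx tie _ _ P
  · intro k hk P x h0 h1
    obtain ⟨j, rfl⟩ := Nat.exists_eq_add_of_le' hk
    obtain ⟨hv0, hv1, hx⟩ := hview P h0 h1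
    refine ⟨isOptimalDoublingState_doublingState hW hx tie _ _ P, fun c hc => ?_⟩
    by_contra! hlt
    exact not_isOptimalDoublingState_both hW hv0 hv1 hx hlt.ne' (Or.inr hlt) hc
  · intro k hk P x h0 h1 c
    obtain ⟨j, rfl⟩ := Nat.exists_eq_add_of_le' hk
    obtain ⟨hv0, hv1, hx⟩ := hview P h0 h1
    refine ⟨fun h => ?_, ?_⟩
    · by_contra hne
      -- At least one double remains after the proposal, so the two slopes differ strictly.
      exact not_isOptimalDoublingState_both (k := j + 1) hW hv0 hv1 hx hne (Or.inl (by omega)) h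
    · rintro rfl
      exact isOptimalDoublingState_doublingState hW hx tie _ _ P
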